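/- Work in a fixed countably saturated nonstandard universe; ${}^*\mathbb N$ is its set of hypernatural numbers, and $\mathbb N\subseteq{}^*\mathbb N$ is the set of standard ones. Borel sets form the least $\sigma$-algebra containing all internal sets. A set $X$ is countably determined (CD) if there are internal sets $X_m$ $(m\in\mathbb N)$ and a family $B\subseteq\mathcal P(\mathbb N)$ with $$X=\bigcup_{b\in B}\Bigl(\bigcap_{m\in b}X_m\cap\bigcap_{m\notin b}\bigl(\textstyle\bigcup_n X_n\setminus X_m\bigr)\Bigr).$$ A map is CD if its graph is CD. Write $X\le_{CD}Y$ if there is a CD injection $X\to Y$, and $X\equiv_{CD}Y$ if $X\le_{CD}Y$ and $Y\le_{CD}X$. A cut is an initial segment of ${}^*\mathbb N$; it is additive if it is closed under addition. For a cut $U$ put $U\mathbb N=\bigcup_{n\in\mathbb N,\,x\in U}[0,xn]$. For a nonnegative hyperrational $\alpha$, $\operatorname{st}\alpha$ is the real number infinitely close to $\alpha$ if $\alpha$ is bounded by a standard number, and $+\infty$ otherwise. 1. If $U$ is an infinite Borel cut, then $U\equiv_{CD}\mathbb N\times U$ and $U\equiv_{CD}U\mathbb N$. 2. If $U\subsetneq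 V$ are Borel cuts and $U$ is additive, then there is no CD map from $U$ onto $V$. 3. Let $x,y\in{}^*\mathbb N$ with $y\ne0$ and $x,y$ not both in $\mathbb N$. Then $[0,x)\equiv_{CD}[0,y)$ if and only if $0<\operatorname{st}(x/y)<\infty$. -/

import Mathlib

universe u

/-- The finite types over the two ground types `ℕ` and `ℝ`. -/
inductive Ty : Type
  | nat : Ty
  | real : Ty
  | prod : Ty → Ty → Ty
  | pow : Ty → Ty
  deriving DecidableEq

/-- The standard objects of each type: numbers, ordered pairs, and all sets. -/
@[reducible] def Std : Ty → Type
  | Ty.nat => ℕ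
  | Ty.real => ℝ
  | Ty.prod a b => Std a × Std b
  | Ty.pow a => Set (Std a)

/-- A (Henkin) frame for the language of finite types with membership and pairing. -/
structure Frame : Type (u + 1) where
  /-- the objects of each type -/
  D : Ty → Type u
  /-- membership of an object of type `a` in an object of type `pow a` -/
  mem : {a : Ty} → D a → D (Ty.pow a) → Prop
  /-- ordered pairs -/
  pair : {a b : Ty} → D a → D b → D (Ty.prod a b)

/-- The standard frame: true membership, true pairs. -/
def stdFrame : Frame.{0} where
  D := Std
  mem := fun x A => x ∈ A
  pair := fun x y => (x, y)

/-- Formulas of the language of finite types. There are variables `x^a_i` for every type `a` and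
every index `i : ℕ`. -/
inductive Fml : Type
  /-- `x^a_i = x^a_j` -/
  | eq (a : Ty) (i j : ℕ) : Fml
  /-- `x^a_i ∈ x^(pow a)_j` -/
  | mem (a : Ty) (i j : ℕ) : Fml
  /-- `x^(prod a b)_k = (x^a_i, x^b_j)` -/
  | pair (a b : Ty) (i j k : ℕ) : Fml
  | neg (φ : Fml) : Fml
  | and (φ ψ : Fml) : Fml
  /-- `∀ x^a_i, φ` -/
  | all (a : Ty) (i : ℕ) (φ : Fml) : Fml

namespace Frame

/-- Values for all the variables. -/
abbrev Assignment (M : Frame.{u}) : Type u := ∀ a : Ty, ℕ → M.D a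

/-- The assignment `v` with the value of `x^a_i` changed to `x`. -/
def Assignment.set {M : Frame.{u}} (v : M.Assignment) (a : Ty) (i : ℕ) (x : M.D a) :
    M.Assignment :=
  Function.update v a (Function.update (v a) i x)

/-- Truth of a formula in a frame. -/
def Sat (M : Frame.{u}) : Fml → M.Assignment → Prop
  | Fml.eq a i j, v => v a i = v a j
  | Fml.mem a i j, v => M.mem (v a i) (v (Ty.pow a) j)
  | Fml.pair a b i j k, v => v (Ty.prod a b) k = M.pair (v a i) (v b j)
  | Fml.neg φ, v => ¬ Sat M φ v
  | Fml.and φ ψ, v => Sat M φ v ∧ Sat M ψ v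
  | Fml.all a i φ, v => ∀ x : M.D a, Sat M φ (v.set a i x)

theorem Assignment.set_self {M : Frame.{u}} (v : M.Assignment) (a : Ty) (i : ℕ) (x : M.D a) :
    v.set a i x a i = x := by
  simp [Assignment.set]

theorem Assignment.set_ne {M : Frame.{u}} (v : M.Assignment) (a : Ty) (i : ℕ) (x : M.D a)
    (b : Ty) (j : ℕ) (h : j ≠ i) : v.set a i x b j = v b j := by
  by_cases hb : b = a
  · subst hb
    simp [Assignment.set, h]
  · simp [Assignment.set, hb]

/-- The formula `∀ x^a_0, ∃ x^b_1, (x_0, x_1) ∈ x_3 ∧ ∀ x^b_4, (x_0, x_4) ∈ x_3 → x_4 = x_1`: the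
relation `x_3` is the graph of a function. -/
def graphFml (a b : Ty) : Fml :=
  let θ : ℕ → Fml := fun i => Fml.neg (Fml.all (Ty.prod a b) 2
    (Fml.neg (Fml.and (Fml.pair a b 0 i 2) (Fml.mem (Ty.prod a b) 2 3))))
  Fml.all a 0 (Fml.neg (Fml.all b 1 (Fml.neg (Fml.and (θ 1)
    (Fml.all b 4 (Fml.neg (Fml.and (θ 4) (Fml.neg (Fml.eq b 4 1)))))))))

theorem sat_graphFml (M : Frame.{u}) (a b : Ty) (v : M.Assignment) :
    M.Sat (graphFml a b) v ↔
      ∀ x : M.D a, ∃! y : M.D b, M.mem (M.pair x y) (v (Ty.pow (Ty.prod a b)) 3) := by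
  simp [graphFml, Frame.Sat, Assignment.set_self, Assignment.set_ne, ExistsUnique]

end Frame

/-- A countably saturated nonstandard universe over the finite types above `ℕ` and `ℝ`: a frame
with a map `star` from the standard objects that satisfies the transfer principle, and in which
every countable family of internal sets with the finite intersection property has a common
element. The members of `D a` are the internal objects of type `a`. -/
structure NonstandardUniverse : Type (u + 1) extends Frame.{u} where
  star : {a : Ty} → Std a → D a
  transfer : ∀ (φ : Fml) (v : stdFrame.Assignment),
    stdFrame.Sat φ v ↔ toFrame.Sat φ (fun a i => star (v a i))
  saturated : ∀ (a : Ty) (A : ℕ → D (Ty.pow a)),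
    (∀ n : ℕ, ∃ x : D a, ∀ i < n, mem x (A i)) → ∃ x : D a, ∀ i, mem x (A i)

namespace NonstandardUniverse

/-- `*f(x)` exists and is unique: the star of the graph of a standard function is the graph of a
function. -/
theorem existsUnique_starFun (M : NonstandardUniverse.{u}) {a b : Ty} (f : Std a → Std b)
    (x : M.D a) :
    ∃! y : M.D b, M.mem (M.pair x y) (M.star (a := Ty.pow (Ty.prod a b)) {p | p.2 = f p.1}) := by
  have hne : ∀ c : Ty, Nonempty (Std c) := by
    intro c
    induction c with
    | nat => exact ⟨(0 : ℕ)⟩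
    | real => exact ⟨(0 : ℝ)⟩
    | prod a b iha ihb => exact ⟨(iha.some, ihb.some)⟩
    | pow a _ => exact ⟨(∅ : Set (Std a))⟩
  let v : stdFrame.Assignment := Frame.Assignment.set (M := stdFrame) (fun c _ => (hne c).some)
    (Ty.pow (Ty.prod a b)) 3 ({p | p.2 = f p.1} : Set (Std a × Std b))
  have hv : v (Ty.pow (Ty.prod a b)) 3 = ({p | p.2 = f p.1} : Set (Std a × Std b)) :=
    Frame.Assignment.set_self _ _ _ _
  have key := (M.transfer (Frame.graphFml a b) v).1
    ((Frame.sat_graphFml _ a b v).2 fun y => by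
      rw [hv]
      exact ⟨f y, rfl, fun z hz => hz⟩)
  have h := (Frame.sat_graphFml _ a b _).1 key x
  rw [hv] at h
  exact h

/-- The extension `*f` of a standard function to the internal objects. -/
noncomputable def starFun (M : NonstandardUniverse.{u}) {a b : Ty} (f : Std a → Std b)
    (x : M.D a) : M.D b :=
  (M.existsUnique_starFun f x).choose

/-- The extension `*R` of a standard binary relation to the internal objects. -/
def starRel (M : NonstandardUniverse.{u}) {a b : Ty} (R : Std a → Std b → Prop)
    (x : M.D a) (y : M.D b) : Prop :=
  M.mem (M.pair x y) (M.star (a := Ty.pow (Ty.prod a b)) {p | R p.1 p.2})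

/-- The hypernatural numbers `*ℕ`. -/
abbrev HNat (M : NonstandardUniverse.{u}) : Type u := M.D Ty.nat

/-- The hyperreal numbers `*ℝ`. -/
abbrev HReal (M : NonstandardUniverse.{u}) : Type u := M.D Ty.real

/-- The set `ℕ` of standard elements of `*ℕ`. -/
def stdNat (M : NonstandardUniverse.{u}) : Set M.HNat :=
  Set.range fun n : ℕ => M.star (a := Ty.nat) n

def le (M : NonstandardUniverse.{u}) (x y : M.HNat) : Prop :=
  M.starRel (a := Ty.nat) (b := Ty.nat) (fun m n : ℕ => m ≤ n) x y

def lt (M : NonstandardUniverse.{u}) (x y : M.HNat) : Prop :=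
  M.starRel (a := Ty.nat) (b := Ty.nat) (fun m n : ℕ => m < n) x y

noncomputable def add (M : NonstandardUniverse.{u}) (x y : M.HNat) : M.HNat :=
  M.starFun (a := Ty.prod Ty.nat Ty.nat) (b := Ty.nat) (fun p : ℕ × ℕ => p.1 + p.2) (M.pair x y)

noncomputable def mul (M : NonstandardUniverse.{u}) (x y : M.HNat) : M.HNat :=
  M.starFun (a := Ty.prod Ty.nat Ty.nat) (b := Ty.nat) (fun p : ℕ × ℕ => p.1 * p.2) (M.pair x y)

/-- The quotient `x / y` of two hypernatural numbers. -/
noncomputable def ratio (M : NonstandardUniverse.{u}) (x y : M.HNat) : M.HReal :=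
  M.starFun (a := Ty.prod Ty.nat Ty.nat) (b := Ty.real) (fun p : ℕ × ℕ => (p.1 : ℝ) / (p.2 : ℝ))
    (M.pair x y)

/-- `α ≃ β`: the difference is infinitesimal, that is, smaller in absolute value than every
standard positive real. -/
def Near (M : NonstandardUniverse.{u}) (α β : M.HReal) : Prop :=
  ∀ ε : ℝ, 0 < ε → M.starRel (a := Ty.real) (b := Ty.real) (fun s t : ℝ => s < t)
    (M.starFun (a := Ty.prod Ty.real Ty.real) (b := Ty.real) (fun p : ℝ × ℝ => |p.1 - p.2|)
      (M.pair α β))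
    (M.star (a := Ty.real) ε)

open Classical in
/-- The standard part of a nonnegative hyperreal: the real number infinitely close to it, or `+∞`
if there is none (that is, if it is unbounded). -/
noncomputable def st (M : NonstandardUniverse.{u}) (α : M.HReal) : EReal :=
  if h : ∃ r : ℝ, M.Near α (M.star (a := Ty.real) r) then ((h.choose : ℝ) : EReal) else ⊤

/-- The set of elements of an internal set. -/
def ext (M : NonstandardUniverse.{u}) {a : Ty} (A : M.D (Ty.pow a)) : Set (M.D a) :=
  {x | M.mem x A}

/-- A set of objects of type `a` is internal if it is the set of elements of an internal object of
type `pow a`. -/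
def IsInternal (M : NonstandardUniverse.{u}) {a : Ty} (X : Set (M.D a)) : Prop :=
  ∃ A : M.D (Ty.pow a), X = M.ext A

/-- Borel sets: the least σ-algebra that contains all internal sets. -/
def IsBorel (M : NonstandardUniverse.{u}) {a : Ty} (X : Set (M.D a)) : Prop :=
  @MeasurableSet _ (MeasurableSpace.generateFrom {Y : Set (M.D a) | M.IsInternal Y}) X

/-- Countably determined sets. -/
def IsCD (M : NonstandardUniverse.{u}) {a : Ty} (X : Set (M.D a)) : Prop :=
  ∃ (Y : ℕ → Set (M.D a)) (B : Set (Set ℕ)), (∀ m, M.IsInternal (Y m)) ∧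
    X = ⋃ b ∈ B, ((⋂ m ∈ b, Y m) ∩ ⋂ m ∈ bᶜ, ((⋃ n, Y n) \ Y m))

/-- A map from `X` to `Y` is countably determined if its graph is. -/
def IsCDMap (M : NonstandardUniverse.{u}) {a b : Ty} {X : Set (M.D a)} {Y : Set (M.D b)}
    (f : X → Y) : Prop :=
  M.IsCD {z : M.D (Ty.prod a b) | ∃ x : X, z = M.pair (x : M.D a) (f x : M.D b)}

/-- There is a countably determined injection of `X` into `Y`. -/
def CDLe (M : NonstandardUniverse.{u}) {a b : Ty} (X : Set (M.D a)) (Y : Set (M.D b)) : Prop :=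
  ∃ f : X → Y, Function.Injective f ∧ M.IsCDMap f

/-- `X ≡_CD Y`. -/
def CDEquiv (M : NonstandardUniverse.{u}) {a b : Ty} (X : Set (M.D a)) (Y : Set (M.D b)) :
    Prop :=
  M.CDLe X Y ∧ M.CDLe Y X

/-- The Cartesian product of two sets, as a set of internal pairs. -/
def prodSet (M : NonstandardUniverse.{u}) {a b : Ty} (X : Set (M.D a)) (Y : Set (M.D b)) :
    Set (M.D (Ty.prod a b)) :=
  {z | ∃ x ∈ X, ∃ y ∈ Y, z = M.pair x y}

/-- Cuts: the initial segments of `*ℕ`. -/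
def IsCut (M : NonstandardUniverse.{u}) (U : Set M.HNat) : Prop :=
  ∀ x ∈ U, ∀ y, M.le y x → y ∈ U

/-- Closure under addition. -/
def IsAdditive (M : NonstandardUniverse.{u}) (U : Set M.HNat) : Prop :=
  ∀ x ∈ U, ∀ y ∈ U, M.add x y ∈ U

/-- `Uℕ = ⋃_{n ∈ ℕ, x ∈ U} [0, xn]`. -/
def mulNat (M : NonstandardUniverse.{u}) (U : Set M.HNat) : Set M.HNat :=
  ⋃ n : ℕ, ⋃ x ∈ U, {y | M.le y (M.mul x (M.star (a := Ty.nat) n))}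

/-- The interval `[0, x)` of `*ℕ`. -/
def below (M : NonstandardUniverse.{u}) (x : M.HNat) : Set M.HNat :=
  {y | M.lt y x}

end NonstandardUniverse

/-!
The positive results rest on the comparison `[0, x)ℕ ≤_CD [0, x)` for infinite `x`. The real line
has an injection into `(0, 1)` that moves every point by a rational number, because every coset of
`ℚ` can be injected into its own intersection with `(0, 1)`. Moving `y ≤ nx` by the rational
multiple of `x` that this injection prescribes for `st (y / x)` brings `y` below `x`, and `y` can be
recovered: the standard part of the new quotient determines the old one, hence also the rational
number. Only countably many rational numbers occur, and each is prescribed on a CD set, since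
whether `st α` lies in a given set of reals depends only on which internal sets `{α | α < q}`,
`q ∈ ℚ`, contain `α`. An infinite cut `U` that is not additive satisfies `Uℕ = [0, x)ℕ` for some
`x ∈ U`, and an additive one satisfies `Uℕ = U`.

For the negative results, saturation covers a CD function by countably many internal functions `fₙ`.
If `v` is infinite, then fewer than `v` numbers are of the form `fₙ u` with `u < v / 2 ^ (n + 2)`
and `n < N`, as the sum of the bounds `v / 2 ^ (n + 2)` stays below `v`. By saturation some `w < v`
differs from all `fₙ u` with `u` infinitely smaller than `v`, so the function does not map the
arguments that are infinitely smaller than `v` onto `[0, v)`.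
-/

/-- The implication `φ → ψ`, written with the connectives of `Fml`. -/
def Fml.imp (φ ψ : Fml) : Fml :=
  Fml.neg (Fml.and φ (Fml.neg ψ))

/-- The equivalence `φ ↔ ψ`, written with the connectives of `Fml`. -/
def Fml.iff (φ ψ : Fml) : Fml :=
  Fml.and (φ.imp ψ) (ψ.imp φ)

theorem Frame.sat_imp (M : Frame.{u}) (φ ψ : Fml) (v : M.Assignment) :
    M.Sat (φ.imp ψ) v ↔ (M.Sat φ v → M.Sat ψ v) := by
  simp only [Fml.imp, Frame.Sat, not_and, not_not]

theorem Frame.sat_iff (M : Frame.{u}) (φ ψ : Fml) (v : M.Assignment) :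
    M.Sat (φ.iff ψ) v ↔ (M.Sat φ v ↔ M.Sat ψ v) := by
  simp only [Fml.iff, Frame.Sat, Frame.sat_imp, iff_iff_implies_and_implies]

/-- The formula `(x^a_i, x^b_j) ∈ x^(pow (prod a b))_k`, which is not atomic. -/
def Fml.memPair (a b : Ty) (i j k : ℕ) : Fml :=
  Fml.all (Ty.prod a b) (i + j + k + 1)
    ((Fml.pair a b i j (i + j + k + 1)).imp (Fml.mem (Ty.prod a b) (i + j + k + 1) k))

theorem Frame.sat_memPair (M : Frame.{u}) (a b : Ty) (i j k : ℕ) (v : M.Assignment) :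
    M.Sat (Fml.memPair a b i j k) v ↔
      M.mem (M.pair (v a i) (v b j)) (v (Ty.pow (Ty.prod a b)) k) := by
  have hi : i ≠ i + j + k + 1 := by omega
  have hj : j ≠ i + j + k + 1 := by omega
  have hk : k ≠ i + j + k + 1 := by omega
  simp only [Fml.memPair, Frame.Sat, Frame.sat_imp, Frame.Assignment.set_self,
    Frame.Assignment.set_ne _ _ _ _ _ _ hi, Frame.Assignment.set_ne _ _ _ _ _ _ hj,
    Frame.Assignment.set_ne _ _ _ _ _ _ hk, forall_eq]

theorem nonempty_stdFrame_assignment : Nonempty stdFrame.Assignment := by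
  have nonempty_std (a : Ty) : Nonempty (Std a) := by
    induction a with
    | nat => exact ⟨(0 : ℕ)⟩
    | real => exact ⟨(0 : ℝ)⟩
    | prod a b iha ihb => exact ⟨(iha.some, ihb.some)⟩
    | pow a _ => exact ⟨(∅ : Set (Std a))⟩
  exact ⟨fun a _ => (nonempty_std a).some⟩

namespace NonstandardUniverse

open Filter Topology Frame

section Transfer

variable (M : NonstandardUniverse.{u}) {a b c : Ty}

theorem mem_star_star (x : Std a) (S : Set (Std a)) :
    M.mem (M.star x) (M.star (a := Ty.pow a) S) ↔ x ∈ S := by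
  suffices ∀ (x : stdFrame.D a) (S : stdFrame.D (Ty.pow a)),
      stdFrame.mem x S ↔ M.mem (M.star x) (M.star S) from (this x S).symm
  intro x S
  obtain ⟨v⟩ := nonempty_stdFrame_assignment
  simpa [Frame.Sat, Assignment.set_self, Assignment.set_ne]
    using M.transfer (Fml.mem a 0 1) ((v.set a 0 x).set (Ty.pow a) 1 S)

theorem star_pair (x : Std a) (y : Std b) :
    M.star (a := Ty.prod a b) (x, y) = M.pair (M.star x) (M.star y) := by
  suffices ∀ (x : stdFrame.D a) (y : stdFrame.D b),
      M.star (stdFrame.pair x y) = M.pair (M.star x) (M.star y) from this x y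
  intro x y
  obtain ⟨v⟩ := nonempty_stdFrame_assignment
  simpa [Frame.Sat, Assignment.set_self, Assignment.set_ne] using
    M.transfer (Fml.pair a b 0 1 2)
      (((v.set a 0 x).set b 1 y).set (Ty.prod a b) 2 (stdFrame.pair x y))

theorem transfer_inter_subset {S T R : stdFrame.D (Ty.pow a)} :
    (∀ x, stdFrame.mem x S → stdFrame.mem x T → stdFrame.mem x R) ↔
      ∀ x, M.mem x (M.star S) → M.mem x (M.star T) → M.mem x (M.star R) := by
  obtain ⟨v⟩ := nonempty_stdFrame_assignment
  simpa [Frame.Sat, sat_imp, Assignment.set_self, Assignment.set_ne] using M.transfer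
    (Fml.all a 0 ((Fml.mem a 0 1).imp ((Fml.mem a 0 2).imp (Fml.mem a 0 3))))
    (((v.set (Ty.pow a) 1 S).set (Ty.pow a) 2 T).set (Ty.pow a) 3 R)

theorem transfer_compl {S T : stdFrame.D (Ty.pow a)} :
    (∀ x, stdFrame.mem x T ↔ ¬ stdFrame.mem x S) ↔
      ∀ x, M.mem x (M.star T) ↔ ¬ M.mem x (M.star S) := by
  obtain ⟨v⟩ := nonempty_stdFrame_assignment
  simpa [Frame.Sat, sat_iff, Assignment.set_self, Assignment.set_ne] using M.transfer
    (Fml.all a 0 ((Fml.mem a 0 2).iff (Fml.neg (Fml.mem a 0 1))))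
    ((v.set (Ty.pow a) 1 S).set (Ty.pow a) 2 T)

theorem transfer_preimage {F : stdFrame.D (Ty.pow (Ty.prod a b))} {S : stdFrame.D (Ty.pow a)}
    {T : stdFrame.D (Ty.pow b)} :
    (∀ x y, stdFrame.mem (stdFrame.pair x y) F → (stdFrame.mem x S ↔ stdFrame.mem y T)) ↔
      ∀ x y, M.mem (M.pair x y) (M.star F) → (M.mem x (M.star S) ↔ M.mem y (M.star T)) := by
  obtain ⟨v⟩ := nonempty_stdFrame_assignment
  simpa [Frame.Sat, sat_imp, sat_iff, sat_memPair, Assignment.set_self, Assignment.set_ne] using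
    M.transfer
      (Fml.all a 0 (Fml.all b 1 ((Fml.memPair a b 0 1 2).imp
        ((Fml.mem a 0 3).iff (Fml.mem b 1 4)))))
      (((v.set (Ty.pow (Ty.prod a b)) 2 F).set (Ty.pow a) 3 S).set (Ty.pow b) 4 T)

theorem transfer_comp {F : stdFrame.D (Ty.pow (Ty.prod a b))}
    {G : stdFrame.D (Ty.pow (Ty.prod b c))} {H : stdFrame.D (Ty.pow (Ty.prod a c))} :
    (∀ x y z, stdFrame.mem (stdFrame.pair x y) F → stdFrame.mem (stdFrame.pair y z) G →
        stdFrame.mem (stdFrame.pair x z) H) ↔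
      ∀ x y z, M.mem (M.pair x y) (M.star F) → M.mem (M.pair y z) (M.star G) →
        M.mem (M.pair x z) (M.star H) := by
  obtain ⟨v⟩ := nonempty_stdFrame_assignment
  simpa [Frame.Sat, sat_imp, sat_memPair, Assignment.set_self, Assignment.set_ne] using
    M.transfer
      (Fml.all a 0 (Fml.all b 1 (Fml.all c 2 ((Fml.memPair a b 0 1 3).imp
        ((Fml.memPair b c 1 2 4).imp (Fml.memPair a c 0 2 5))))))
      (((v.set (Ty.pow (Ty.prod a b)) 3 F).set (Ty.pow (Ty.prod b c)) 4 G).set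
        (Ty.pow (Ty.prod a c)) 5 H)

theorem transfer_pair {F : stdFrame.D (Ty.pow (Ty.prod a b))}
    {G : stdFrame.D (Ty.pow (Ty.prod a c))} {H : stdFrame.D (Ty.pow (Ty.prod a (Ty.prod b c)))} :
    (∀ x y z, stdFrame.mem (stdFrame.pair x y) F → stdFrame.mem (stdFrame.pair x z) G →
        stdFrame.mem (stdFrame.pair x (stdFrame.pair y z)) H) ↔
      ∀ x y z, M.mem (M.pair x y) (M.star F) → M.mem (M.pair x z) (M.star G) →
        M.mem (M.pair x (M.pair y z)) (M.star H) := by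
  obtain ⟨v⟩ := nonempty_stdFrame_assignment
  simpa [Frame.Sat, sat_imp, sat_memPair, Assignment.set_self, Assignment.set_ne] using
    M.transfer
      (Fml.all a 0 (Fml.all b 1 (Fml.all c 2 (Fml.all (Ty.prod b c) 3 ((Fml.pair b c 1 2 3).imp
        ((Fml.memPair a b 0 1 4).imp ((Fml.memPair a c 0 2 5).imp
          (Fml.memPair a (Ty.prod b c) 0 3 6))))))))
      (((v.set (Ty.pow (Ty.prod a b)) 4 F).set (Ty.pow (Ty.prod a c)) 5 G).set
        (Ty.pow (Ty.prod a (Ty.prod b c))) 6 H)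

theorem transfer_eq {D : stdFrame.D (Ty.pow (Ty.prod a a))} :
    (∀ x y, stdFrame.mem (stdFrame.pair x y) D ↔ x = y) ↔
      ∀ x y, M.mem (M.pair x y) (M.star D) ↔ x = y := by
  obtain ⟨v⟩ := nonempty_stdFrame_assignment
  simpa [Frame.Sat, sat_iff, sat_memPair, Assignment.set_self, Assignment.set_ne] using
    M.transfer (Fml.all a 0 (Fml.all a 1 ((Fml.memPair a a 0 1 2).iff (Fml.eq a 0 1))))
      (v.set (Ty.pow (Ty.prod a a)) 2 D)

theorem transfer_mem {E : stdFrame.D (Ty.pow (Ty.prod a (Ty.pow a)))} :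
    (∀ x A, stdFrame.mem (stdFrame.pair x A) E ↔ stdFrame.mem x A) ↔
      ∀ x A, M.mem (M.pair x A) (M.star E) ↔ M.mem x A := by
  obtain ⟨v⟩ := nonempty_stdFrame_assignment
  simpa [Frame.Sat, sat_iff, sat_memPair, Assignment.set_self, Assignment.set_ne] using
    M.transfer
      (Fml.all a 0 (Fml.all (Ty.pow a) 1 ((Fml.memPair a (Ty.pow a) 0 1 2).iff (Fml.mem a 0 1))))
      (v.set (Ty.pow (Ty.prod a (Ty.pow a))) 2 E)

theorem transfer_fst {F : stdFrame.D (Ty.pow (Ty.prod (Ty.prod a b) a))} :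
    (∀ x y, stdFrame.mem (stdFrame.pair (stdFrame.pair x y) x) F) ↔
      ∀ x y, M.mem (M.pair (M.pair x y) x) (M.star F) := by
  obtain ⟨v⟩ := nonempty_stdFrame_assignment
  simpa [Frame.Sat, sat_imp, sat_memPair, Assignment.set_self, Assignment.set_ne] using
    M.transfer
      (Fml.all a 0 (Fml.all b 1 (Fml.all (Ty.prod a b) 2 ((Fml.pair a b 0 1 2).imp
        (Fml.memPair (Ty.prod a b) a 2 0 3)))))
      (v.set (Ty.pow (Ty.prod (Ty.prod a b) a)) 3 F)

theorem transfer_snd {F : stdFrame.D (Ty.pow (Ty.prod (Ty.prod a b) b))} :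
    (∀ x y, stdFrame.mem (stdFrame.pair (stdFrame.pair x y) y) F) ↔
      ∀ x y, M.mem (M.pair (M.pair x y) y) (M.star F) := by
  obtain ⟨v⟩ := nonempty_stdFrame_assignment
  simpa [Frame.Sat, sat_imp, sat_memPair, Assignment.set_self, Assignment.set_ne] using
    M.transfer
      (Fml.all a 0 (Fml.all b 1 (Fml.all (Ty.prod a b) 2 ((Fml.pair a b 0 1 2).imp
        (Fml.memPair (Ty.prod a b) b 2 1 3)))))
      (v.set (Ty.pow (Ty.prod (Ty.prod a b) b)) 3 F)

theorem mem_star_of_inter_subset {S T R : Set (Std a)} (h : S ∩ T ⊆ R) {x : M.D a}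
    (hS : M.mem x (M.star (a := Ty.pow a) S)) (hT : M.mem x (M.star (a := Ty.pow a) T)) :
    M.mem x (M.star (a := Ty.pow a) R) :=
  M.transfer_inter_subset.1 (fun _ hxS hxT => h ⟨hxS, hxT⟩) x hS hT

theorem mem_star_compl (x : M.D a) (S : Set (Std a)) :
    M.mem x (M.star (a := Ty.pow a) Sᶜ) ↔ ¬ M.mem x (M.star (a := Ty.pow a) S) :=
  M.transfer_compl.1 (fun _ => Iff.rfl) x

/-- The ultrafilter on the standard objects determined by an internal object `x`: the sets `S`
with `x ∈ *S`. -/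
def ultra (x : M.D a) : Ultrafilter (Std a) :=
  Ultrafilter.ofComplNotMemIff
    { sets := {S | M.mem x (M.star (a := Ty.pow a) S)}
      univ_sets := by
        by_contra hx
        have hx' := (M.mem_star_compl x Set.univ).2 hx
        exact hx (M.mem_star_of_inter_subset (Set.subset_univ _) hx' hx')
      sets_of_superset := fun hS hST =>
        M.mem_star_of_inter_subset (Set.inter_subset_left.trans hST) hS hS
      inter_sets := fun hS hT => M.mem_star_of_inter_subset subset_rfl hS hT }
    fun S => by
      change ¬ M.mem x (M.star (a := Ty.pow a) Sᶜ) ↔ M.mem x (M.star (a := Ty.pow a) S)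
      rw [mem_star_compl, not_not]

theorem starFun_spec (f : Std a → Std b) (x : M.D a) :
    M.mem (M.pair x (M.starFun f x)) (M.star (a := Ty.pow (Ty.prod a b)) {p | p.2 = f p.1}) :=
  (M.existsUnique_starFun f x).choose_spec.1

theorem starFun_eq {f : Std a → Std b} {x : M.D a} {y : M.D b}
    (h : M.mem (M.pair x y) (M.star (a := Ty.pow (Ty.prod a b)) {p | p.2 = f p.1})) :
    M.starFun f x = y :=
  (M.existsUnique_starFun f x).unique (M.starFun_spec f x) h

theorem starFun_star (f : Std a → Std b) (x : Std a) :
    M.starFun f (M.star x) = M.star (f x) := by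
  apply M.starFun_eq
  rw [← star_pair, mem_star_star]
  rfl

theorem starFun_starFun (g : Std b → Std c) (f : Std a → Std b) (x : M.D a) :
    M.starFun g (M.starFun f x) = M.starFun (fun t => g (f t)) x :=
  (M.starFun_eq (M.transfer_comp.1 (by rintro x y z (rfl : y = f x) (rfl : z = g (f x)); rfl) _ _ _
    (M.starFun_spec f x) (M.starFun_spec g _))).symm

theorem pair_starFun (f : Std a → Std b) (g : Std a → Std c) (x : M.D a) :
    M.pair (M.starFun f x) (M.starFun g x) =
      M.starFun (b := Ty.prod b c) (fun t => (f t, g t)) x :=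
  (M.starFun_eq (b := Ty.prod b c) (M.transfer_pair.1
    (by rintro x y z (rfl : y = f x) (rfl : z = g x); rfl) _ _ _
    (M.starFun_spec f x) (M.starFun_spec g x))).symm

theorem mem_star_preimage (f : Std a → Std b) (x : M.D a) (S : Set (Std b)) :
    M.mem x (M.star (a := Ty.pow a) (f ⁻¹' S)) ↔
      M.mem (M.starFun f x) (M.star (a := Ty.pow b) S) :=
  M.transfer_preimage.1 (by rintro x y (rfl : y = f x); rfl) _ _ (M.starFun_spec f x)

theorem ultra_starFun (f : Std a → Std b) (x : M.D a) :
    (M.ultra (M.starFun f x) : Filter (Std b)) = Filter.map f (M.ultra x) := by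
  ext S
  exact (M.mem_star_preimage f x S).symm

theorem starRel_starFun (R : Std b → Std c → Prop) (f : Std a → Std b) (g : Std a → Std c)
    (x : M.D a) :
    M.starRel R (M.starFun f x) (M.starFun g x) ↔ ∀ᶠ t in M.ultra x, R (f t) (g t) := by
  rw [starRel, pair_starFun]
  exact (M.mem_star_preimage (b := Ty.prod b c) (fun t => (f t, g t)) x {p | R p.1 p.2}).symm

theorem starFun_eq_starFun_iff (f g : Std a → Std b) (x : M.D a) :
    M.starFun f x = M.starFun g x ↔ ∀ᶠ t in M.ultra x, f t = g t := by
  rw [← M.starRel_starFun (b := b) (c := b) Eq]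
  exact (M.transfer_eq.1 (fun _ _ => Iff.rfl) _ _).symm

theorem mem_starFun_iff (f : Std a → Std b) (A : Std a → Set (Std b)) (x : M.D a) :
    M.mem (M.starFun f x) (M.starFun (b := Ty.pow b) A x) ↔ ∀ᶠ t in M.ultra x, f t ∈ A t := by
  rw [← M.starRel_starFun (b := b) (c := Ty.pow b) (fun y (Y : Set (Std b)) => y ∈ Y)]
  exact (M.transfer_mem.1 (fun _ _ => Iff.rfl) _ _).symm

/-- The first component of an internal pair. -/
noncomputable def fst (z : M.D (Ty.prod a b)) : M.D a :=
  M.starFun (a := Ty.prod a b) (b := a) (fun p : Std a × Std b => p.1) z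

/-- The second component of an internal pair. -/
noncomputable def snd (z : M.D (Ty.prod a b)) : M.D b :=
  M.starFun (a := Ty.prod a b) (b := b) (fun p : Std a × Std b => p.2) z

@[simp] theorem fst_pair (x : M.D a) (y : M.D b) : M.fst (M.pair x y) = x :=
  M.starFun_eq (a := Ty.prod a b) ((M.transfer_fst (F := {p | p.2 = p.1.1})).1 (fun _ _ => rfl) x y)

@[simp] theorem snd_pair (x : M.D a) (y : M.D b) : M.snd (M.pair x y) = y :=
  M.starFun_eq (a := Ty.prod a b) ((M.transfer_snd (F := {p | p.2 = p.1.2})).1 (fun _ _ => rfl) x y)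

theorem pair_injective {x x' : M.D a} {y y' : M.D b} (h : M.pair x y = M.pair x' y') :
    x = x' ∧ y = y' := by
  have hfst := congrArg M.fst h
  have hsnd := congrArg M.snd h
  rw [fst_pair, fst_pair] at hfst
  rw [snd_pair, snd_pair] at hsnd
  exact ⟨hfst, hsnd⟩

theorem starFun_id (x : M.D a) : M.starFun (fun t => t) x = x := by
  conv_lhs => rw [← M.fst_pair x x]
  rw [fst, starFun_starFun]
  exact M.fst_pair x x

@[simp] theorem pair_fst_snd (z : M.D (Ty.prod a b)) : M.pair (M.fst z) (M.snd z) = z := by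
  rw [fst, snd, pair_starFun]
  exact M.starFun_id z

theorem starFun_fst_fst_snd (z : M.D (Ty.prod a (Ty.prod b c))) :
    M.starFun (a := Ty.prod a (Ty.prod b c)) (b := Ty.prod a b)
      (fun p : Std a × Std b × Std c => (p.1, p.2.1)) z = M.pair (M.fst z) (M.fst (M.snd z)) := by
  rw [fst, fst, snd, starFun_starFun, pair_starFun]

theorem starFun_fst_snd_snd (z : M.D (Ty.prod a (Ty.prod b c))) :
    M.starFun (a := Ty.prod a (Ty.prod b c)) (b := Ty.prod a c)
      (fun p : Std a × Std b × Std c => (p.1, p.2.2)) z = M.pair (M.fst z) (M.snd (M.snd z)) := by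
  rw [fst, snd, snd, starFun_starFun, pair_starFun]

theorem starFun_swap (x : M.D a) (y : M.D b) :
    M.starFun (a := Ty.prod a b) (b := Ty.prod b a) (fun p : Std a × Std b => (p.2, p.1))
      (M.pair x y) = M.pair y x := by
  have h := M.pair_starFun (a := Ty.prod a b) (b := b) (c := a) Prod.snd Prod.fst (M.pair x y)
  exact h.symm.trans (congrArg₂ M.pair (M.snd_pair x y) (M.fst_pair x y))

theorem starFun_const (s : Std b) (x : M.D a) : M.starFun (fun _ => s) x = M.star s := by
  have h : M.starFun (a := Ty.prod a b) (fun _ => s) (M.pair x (M.star s)) =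
      M.snd (M.pair x (M.star s)) := by
    refine (M.starFun_eq_starFun_iff (a := Ty.prod a b) _ _ _).2 ?_
    refine (M.mem_star_preimage (a := Ty.prod a b) _ _ {t | s = t}).2 ?_
    exact (congrArg (M.mem · _) (M.snd_pair x _)).mpr ((M.mem_star_star s {t | s = t}).2 rfl)
  rw [snd_pair] at h
  conv_lhs => rw [← M.fst_pair x (M.star s)]
  rw [fst, starFun_starFun, h]

theorem exists_starFun₂ (x : M.D a) (y : M.D b) : ∃ (e : Ty) (t : M.D e)
    (f : Std e → Std a) (g : Std e → Std b), x = M.starFun f t ∧ y = M.starFun g t :=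
  ⟨Ty.prod a b, M.pair x y, Prod.fst, Prod.snd, (M.fst_pair x y).symm, (M.snd_pair x y).symm⟩

theorem exists_starFun₃ (x : M.D a) (y : M.D b) (z : M.D c) : ∃ (e : Ty) (t : M.D e)
    (f : Std e → Std a) (g : Std e → Std b) (h : Std e → Std c),
    x = M.starFun f t ∧ y = M.starFun g t ∧ z = M.starFun h t := by
  obtain ⟨e, t, f, g, rfl, rfl⟩ := M.exists_starFun₂ x y
  obtain ⟨e', t', f', g', rfl, rfl⟩ := M.exists_starFun₂ t z
  exact ⟨e', t', _, _, _, M.starFun_starFun _ _ _, M.starFun_starFun _ _ _, rfl⟩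

theorem starFun_injective {f : Std a → Std b} (hf : Function.Injective f) :
    Function.Injective (M.starFun f) := by
  intro x y hxy
  obtain ⟨e, t, g, h, rfl, rfl⟩ := M.exists_starFun₂ x y
  rw [starFun_starFun, starFun_starFun, starFun_eq_starFun_iff] at hxy
  rw [starFun_eq_starFun_iff]
  exact hxy.mono fun s hs => hf hs

theorem exists_starFun_of_lt (A : ℕ → M.D a) (N : ℕ) :
    ∃ (e : Ty) (t : M.D e) (f : ℕ → Std e → Std a), ∀ n < N, A n = M.starFun (f n) t := by
  induction N with
  | zero => exact ⟨a, A 0, fun _ x => x, by simp⟩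
  | succ N ih =>
    obtain ⟨e, t, f, hf⟩ := ih
    obtain ⟨e', t', g, h, rfl, hh⟩ := M.exists_starFun₂ t (A N)
    refine ⟨e', t', fun n => if n < N then fun s => f n (g s) else h, fun n hn => ?_⟩
    rcases Nat.lt_succ_iff_lt_or_eq.1 hn with hn | rfl
    · simp only [hf n hn, starFun_starFun, if_pos hn]
    · simp only [hh, if_neg (lt_irrefl n)]

/-- Every value of an internal choice is represented by a standard choice: this is the quantifier
step of Łoś's theorem. -/
theorem exists_starRel_iff (R : Std a → Std b → Prop) (x : M.D a) :
    (∃ y, M.starRel R x y) ↔ ∀ᶠ s in M.ultra x, ∃ r, R s r := by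
  constructor
  · rintro ⟨y, hy⟩
    obtain ⟨e, t, f, g, rfl, rfl⟩ := M.exists_starFun₂ x y
    rw [starRel_starFun] at hy
    rw [ultra_starFun, eventually_map]
    exact hy.mono fun s hs => ⟨g s, hs⟩
  · intro h
    obtain ⟨f, hf⟩ := h.choice
    refine ⟨M.starFun f x, ?_⟩
    rw [← M.starFun_id x, starFun_starFun, starRel_starFun]
    exact hf

theorem le_starFun (f g : Std a → ℕ) (x : M.D a) :
    M.le (M.starFun (b := Ty.nat) f x) (M.starFun (b := Ty.nat) g x) ↔
      ∀ᶠ t in M.ultra x, f t ≤ g t :=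
  M.starRel_starFun (b := Ty.nat) (c := Ty.nat) _ f g x

theorem lt_starFun (f g : Std a → ℕ) (x : M.D a) :
    M.lt (M.starFun (b := Ty.nat) f x) (M.starFun (b := Ty.nat) g x) ↔
      ∀ᶠ t in M.ultra x, f t < g t :=
  M.starRel_starFun (b := Ty.nat) (c := Ty.nat) _ f g x

theorem add_starFun (f g : Std a → ℕ) (x : M.D a) :
    M.add (M.starFun (b := Ty.nat) f x) (M.starFun (b := Ty.nat) g x) =
      M.starFun (b := Ty.nat) (fun t => f t + g t) x := by
  rw [add, pair_starFun]
  exact M.starFun_starFun (b := Ty.prod Ty.nat Ty.nat) (c := Ty.nat) _ _ _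

theorem mul_starFun (f g : Std a → ℕ) (x : M.D a) :
    M.mul (M.starFun (b := Ty.nat) f x) (M.starFun (b := Ty.nat) g x) =
      M.starFun (b := Ty.nat) (fun t => f t * g t) x := by
  rw [mul, pair_starFun]
  exact M.starFun_starFun (b := Ty.prod Ty.nat Ty.nat) (c := Ty.nat) _ _ _

theorem mul_starFun_star (f : Std a → ℕ) (n : ℕ) (x : M.D a) :
    M.mul (M.starFun (b := Ty.nat) f x) (M.star (a := Ty.nat) n) =
      M.starFun (b := Ty.nat) (fun t => f t * n) x := by
  rw [← M.starFun_const (b := Ty.nat) n x]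
  exact M.mul_starFun f (fun _ => n) x

theorem ratio_starFun (f g : Std a → ℕ) (x : M.D a) :
    M.ratio (M.starFun (b := Ty.nat) f x) (M.starFun (b := Ty.nat) g x) =
      M.starFun (b := Ty.real) (fun t => (f t : ℝ) / (g t : ℝ)) x := by
  rw [ratio, pair_starFun]
  exact M.starFun_starFun (b := Ty.prod Ty.nat Ty.nat) (c := Ty.real) _ _ _

end Transfer

section Internal

variable {M : NonstandardUniverse.{u}} {a b : Ty}

theorem mem_ext {x : M.D a} {A : M.D (Ty.pow a)} : x ∈ M.ext A ↔ M.mem x A :=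
  Iff.rfl

theorem mem_iff_starRel (x : M.D a) (A : M.D (Ty.pow a)) :
    M.mem x A ↔ M.starRel (b := Ty.pow a) (fun s (S : Set (Std a)) => s ∈ S) x A :=
  (M.transfer_mem.1 (fun _ _ => Iff.rfl) x A).symm

theorem isInternal_starRel (R : Std a → Std b → Prop) (p : M.D b) :
    M.IsInternal {x : M.D a | M.starRel R x p} := by
  refine ⟨M.starFun (b := Ty.pow a) (fun t => {s | R s t}) p, Set.ext fun x => ?_⟩
  obtain ⟨e, t, f, g, rfl, rfl⟩ := M.exists_starFun₂ x p
  rw [starFun_starFun]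
  exact (M.starRel_starFun R f g t).trans (M.mem_starFun_iff f (fun s => {r | R r (g s)}) t).symm

theorem isInternal_eventually (P : Std a → Prop) :
    M.IsInternal {x : M.D a | ∀ᶠ s in M.ultra x, P s} :=
  ⟨M.star (a := Ty.pow a) {s | P s}, rfl⟩

theorem isInternal_starFun_eq (f g : Std a → Std b) :
    M.IsInternal {x : M.D a | M.starFun f x = M.starFun g x} := by
  simp only [starFun_eq_starFun_iff]
  exact isInternal_eventually fun s => f s = g s

theorem isInternal_singleton (x : M.D a) : M.IsInternal ({x} : Set (M.D a)) := by
  convert isInternal_starRel (Eq : Std a → Std a → Prop) x using 1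
  ext y
  exact (M.transfer_eq.1 (fun _ _ => Iff.rfl) y x).symm

theorem isInternal_univ : M.IsInternal (Set.univ : Set (M.D a)) := by
  convert isInternal_eventually (M := M) (fun _ : Std a => True) using 1
  simp only [eventually_true, Set.ofPred_true]

theorem IsInternal.compl {Y : Set (M.D a)} (hY : M.IsInternal Y) : M.IsInternal Yᶜ := by
  obtain ⟨A, rfl⟩ := hY
  convert isInternal_starRel (b := Ty.pow a) (fun s (S : Set (Std a)) => s ∉ S) A using 1
  ext x
  rw [Set.mem_compl_iff, mem_ext, mem_iff_starRel, Set.mem_ofPred_eq]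
  obtain ⟨e, t, g, S, rfl, rfl⟩ := M.exists_starFun₂ x A
  rw [starRel_starFun, starRel_starFun, Ultrafilter.eventually_not]

theorem IsInternal.inter {Y Z : Set (M.D a)} (hY : M.IsInternal Y) (hZ : M.IsInternal Z) :
    M.IsInternal (Y ∩ Z) := by
  obtain ⟨A, rfl⟩ := hY
  obtain ⟨B, rfl⟩ := hZ
  convert isInternal_starRel (b := Ty.prod (Ty.pow a) (Ty.pow a))
    (fun s (S : Set (Std a) × Set (Std a)) => s ∈ S.1 ∩ S.2) (M.pair A B) using 1
  ext x
  obtain ⟨e, t, g, S, T, rfl, rfl, rfl⟩ := M.exists_starFun₃ x A B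
  rw [Set.mem_inter_iff, mem_ext, mem_ext, Set.mem_ofPred_eq, pair_starFun, starRel_starFun,
    mem_starFun_iff, mem_starFun_iff]
  exact eventually_and.symm

theorem isInternal_empty : M.IsInternal (∅ : Set (M.D a)) := by
  simpa only [Set.compl_univ] using (isInternal_univ (M := M) (a := a)).compl

theorem isInternal_biInter_lt {Y : ℕ → Set (M.D a)} (hY : ∀ n, M.IsInternal (Y n)) (k : ℕ) :
    M.IsInternal (⋂ i < k, Y i) := by
  induction k with
  | zero => simpa using isInternal_univ
  | succ k ih =>
    rw [Set.biInter_lt_succ]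
    exact ih.inter (hY k)

theorem IsInternal.preimage {Y : Set (M.D b)} (hY : M.IsInternal Y) (f : Std a → Std b) :
    M.IsInternal (M.starFun f ⁻¹' Y) := by
  obtain ⟨A, rfl⟩ := hY
  convert isInternal_starRel (b := Ty.pow b) (fun s (S : Set (Std b)) => f s ∈ S) A using 1
  ext x
  obtain ⟨e, t, g, S, rfl, rfl⟩ := M.exists_starFun₂ x A
  rw [Set.mem_preimage, mem_ext, Set.mem_ofPred_eq, starFun_starFun, starRel_starFun]
  exact M.mem_starFun_iff _ S t

theorem IsInternal.preimage_pair {Y : Set (M.D (Ty.prod a b))} (hY : M.IsInternal Y) (p : M.D b) :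
    M.IsInternal {x : M.D a | M.pair x p ∈ Y} := by
  obtain ⟨A, rfl⟩ := hY
  convert isInternal_starRel (b := Ty.prod b (Ty.pow (Ty.prod a b)))
    (fun s (w : Std b × Set (Std a × Std b)) => (s, w.1) ∈ w.2) (M.pair p A) using 1
  ext x
  obtain ⟨e, t, f, g, S, rfl, rfl, rfl⟩ := M.exists_starFun₃ x p A
  rw [Set.mem_ofPred_eq, mem_ext, pair_starFun, pair_starFun, Set.mem_ofPred_eq, starRel_starFun]
  exact M.mem_starFun_iff (b := Ty.prod a b) (fun s => (f s, g s)) S t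

theorem IsInternal.image {Y : Set (M.D a)} (hY : M.IsInternal Y) (f : Std a → Std b) :
    M.IsInternal (M.starFun f '' Y) := by
  obtain ⟨A, rfl⟩ := hY
  convert isInternal_starRel (b := Ty.pow a)
    (fun r (S : Set (Std a)) => ∃ s, s ∈ S ∧ f s = r) A using 1
  ext w
  obtain ⟨e, t, g, S, rfl, rfl⟩ := M.exists_starFun₂ w A
  rw [Set.mem_image, Set.mem_ofPred_eq, starRel_starFun, ← exists_starRel_iff]
  refine exists_congr fun x => ?_
  obtain ⟨e', t', h, k, rfl, rfl⟩ := M.exists_starFun₂ t x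
  rw [mem_ext, starFun_starFun, starFun_starFun, starFun_starFun, starRel_starFun, mem_starFun_iff,
    starFun_eq_starFun_iff]
  exact eventually_and.symm

theorem nonempty_iInter_of_biInter_lt {Y : ℕ → Set (M.D a)} (hY : ∀ n, M.IsInternal (Y n))
    (h : ∀ n, (⋂ i < n, Y i).Nonempty) : (⋂ i, Y i).Nonempty := by
  choose A hA using hY
  obtain rfl : Y = fun n => M.ext (A n) := funext hA
  obtain ⟨x, hx⟩ := M.saturated a A fun n => (h n).imp fun x hx => Set.mem_iInter₂.1 hx
  exact ⟨x, Set.mem_iInter.2 hx⟩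

theorem nonempty_iInter_of_antitone {Y : ℕ → Set (M.D a)} (hY : ∀ n, M.IsInternal (Y n))
    (hanti : Antitone Y) (h : ∀ n, (Y n).Nonempty) : (⋂ i, Y i).Nonempty :=
  nonempty_iInter_of_biInter_lt hY fun n =>
    (h n).mono (Set.subset_iInter₂ fun _ hi => hanti hi.le)

end Internal

section CountablyDetermined

variable {M : NonstandardUniverse.{u}} {a b c : Ty}

theorem isCD_of_forall {ι : Type*} [Countable ι] {X : Set (M.D a)} (Y : ι → Set (M.D a))
    (hY : ∀ i, M.IsInternal (Y i))
    (h : ∀ z z', (∀ i, z ∈ Y i ↔ z' ∈ Y i) → z ∈ X → z' ∈ X) : M.IsCD X := by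
  let Z : Option ι → Set (M.D a) := fun o => o.elim Set.univ Y
  obtain ⟨e, he⟩ := exists_surjective_nat (Option ι)
  have hZ : ∀ o, M.IsInternal (Z o) := Option.forall.2 ⟨isInternal_univ, hY⟩
  have huniv : ⋃ n, Z (e n) = Set.univ := by
    obtain ⟨n, hn⟩ := he none
    exact Set.eq_univ_of_forall fun z => Set.mem_iUnion.2 ⟨n, by rw [hn]; trivial⟩
  refine ⟨fun n => Z (e n), {s | ∃ z ∈ X, s = {n | z ∈ Z (e n)}}, fun n => hZ _, ?_⟩
  ext z
  simp only [huniv, Set.mem_iUnion, Set.mem_inter_iff, Set.mem_iInter, exists_prop]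
  constructor
  · intro hz
    exact ⟨_, ⟨z, hz, rfl⟩, fun n hn => hn, fun n hn => ⟨trivial, hn⟩⟩
  · rintro ⟨_, ⟨z', hz', rfl⟩, hmem, hnotMem⟩
    refine h z' z (fun i => ?_) hz'
    obtain ⟨n, hn⟩ := he (some i)
    have hi : Z (e n) = Y i := by rw [hn]; rfl
    exact hi ▸ ⟨hmem n, fun hz => by_contra fun hz'' => (hnotMem n hz'').2 hz⟩

theorem IsCD.exists_forall {X : Set (M.D a)} (hX : M.IsCD X) :
    ∃ Y : ℕ → Set (M.D a), (∀ m, M.IsInternal (Y m)) ∧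
      ∀ z z', (∀ m, z ∈ Y m ↔ z' ∈ Y m) → z ∈ X → z' ∈ X := by
  obtain ⟨Y, B, hY, rfl⟩ := hX
  refine ⟨Y, hY, fun z z' h hz => ?_⟩
  simpa [h] using hz

theorem IsInternal.isCD {X : Set (M.D a)} (hX : M.IsInternal X) : M.IsCD X :=
  isCD_of_forall (fun _ : Unit => X) (fun _ => hX) fun _ _ h => (h ()).1

theorem IsCD.compl {X : Set (M.D a)} (hX : M.IsCD X) : M.IsCD Xᶜ := by
  obtain ⟨Y, hY, h⟩ := hX.exists_forall
  exact isCD_of_forall Y hY fun z z' hz hz' h' => hz' (h z' z (fun m => (hz m).symm) h')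

theorem IsCD.iUnion {ι : Type*} [Countable ι] {X : ι → Set (M.D a)} (hX : ∀ i, M.IsCD (X i)) :
    M.IsCD (⋃ i, X i) := by
  choose Y hY h using fun i => (hX i).exists_forall
  refine isCD_of_forall (fun p : ι × ℕ => Y p.1 p.2) (fun p => hY _ _) fun z z' hz hz' => ?_
  obtain ⟨i, hi⟩ := Set.mem_iUnion.1 hz'
  exact Set.mem_iUnion.2 ⟨i, h i z z' (fun m => hz (i, m)) hi⟩

/-- The `σ`-algebra of countably determined sets. -/
@[reducible] def cdMeasurableSpace (M : NonstandardUniverse.{u}) (a : Ty) :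
    MeasurableSpace (M.D a) where
  MeasurableSet' := M.IsCD
  measurableSet_empty := isInternal_empty.isCD
  measurableSet_compl _ := IsCD.compl
  measurableSet_iUnion _ := IsCD.iUnion

theorem IsCD.inter {X Y : Set (M.D a)} (hX : M.IsCD X) (hY : M.IsCD Y) : M.IsCD (X ∩ Y) :=
  MeasurableSet.inter (m := M.cdMeasurableSpace a) hX hY

theorem IsBorel.isCD {X : Set (M.D a)} (hX : M.IsBorel X) : M.IsCD X :=
  MeasurableSpace.generateFrom_le (m := M.cdMeasurableSpace a)
    (fun _ hY => IsInternal.isCD hY) X hX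

theorem IsCD.preimage {Y : Set (M.D b)} (hY : M.IsCD Y) (f : Std a → Std b) :
    M.IsCD (M.starFun f ⁻¹' Y) := by
  obtain ⟨Z, hZ, h⟩ := hY.exists_forall
  exact isCD_of_forall (fun m => M.starFun f ⁻¹' Z m) (fun m => (hZ m).preimage f)
    fun z z' hz => h _ _ hz

theorem IsCD.preimage_pair {Y : Set (M.D (Ty.prod a b))} (hY : M.IsCD Y) (p : M.D b) :
    M.IsCD {x : M.D a | M.pair x p ∈ Y} := by
  obtain ⟨Z, hZ, h⟩ := hY.exists_forall
  exact isCD_of_forall (fun m => {x | M.pair x p ∈ Z m}) (fun m => (hZ m).preimage_pair p)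
    fun _ _ hz => h _ _ hz

theorem IsCD.exists_antitone {X : Set (M.D a)} (hX : M.IsCD X) :
    ∃ 𝒴 : Set (Set (M.D a)), 𝒴.Countable ∧ (∀ C ∈ 𝒴, M.IsInternal C) ∧
      ∀ z ∈ X, ∃ C : ℕ → Set (M.D a), (∀ k, C k ∈ 𝒴) ∧ Antitone C ∧ (∀ k, z ∈ C k) ∧
        ⋂ k, C k ⊆ X := by
  obtain ⟨Y, hY, h⟩ := hX.exists_forall
  let K : ℕ × Finset ℕ → Set (M.D a) := fun p => ⋂ i < p.1, if i ∈ p.2 then Y i else (Y i)ᶜ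
  refine ⟨Set.range K, Set.countable_range K, ?_, fun z hz => ?_⟩
  · rintro _ ⟨p, rfl⟩
    refine isInternal_biInter_lt (fun i => ?_) p.1
    split_ifs
    exacts [hY i, (hY i).compl]
  classical
  refine ⟨fun k => {z' | ∀ i < k, z ∈ Y i ↔ z' ∈ Y i}, fun k => ?_,
    fun k l hkl z' hz' i hi => hz' i (hi.trans_le hkl), fun k i _ => Iff.rfl, fun z' hz' => ?_⟩
  · refine ⟨(k, (Finset.range k).filter fun i => z ∈ Y i), Set.ext fun z' => ?_⟩
    simp only [K, Set.mem_iInter]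
    refine forall₂_congr fun i hi => ?_
    by_cases hzi : z ∈ Y i <;> simp [hi, hzi]
  · exact h z z' (fun m => Set.mem_iInter.1 hz' (m + 1) m m.lt_succ_self) hz

/-- By saturation, the image of a decreasing intersection of internal sets is the intersection of
their images. -/
theorem IsCD.image {X : Set (M.D a)} (hX : M.IsCD X) (f : Std a → Std b) :
    M.IsCD (M.starFun f '' X) := by
  obtain ⟨𝒴, hcount, h𝒴, h⟩ := hX.exists_antitone
  have := hcount.to_subtype
  refine isCD_of_forall (fun C : 𝒴 => M.starFun f '' C) (fun C => (h𝒴 C C.2).image f) ?_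
  rintro _ w' hw ⟨z, hz, rfl⟩
  obtain ⟨C, hC, hanti, hzC, hCX⟩ := h z hz
  obtain ⟨z', hz'⟩ := nonempty_iInter_of_antitone (Y := fun k => C k ∩ M.starFun f ⁻¹' {w'})
    (fun k => (h𝒴 _ (hC k)).inter ((isInternal_singleton w').preimage f))
    (fun k l hkl => Set.inter_subset_inter_left _ (hanti hkl))
    fun k => (hw ⟨C k, hC k⟩).1 ⟨z, hzC k, rfl⟩
  rw [← Set.iInter_inter] at hz'
  exact ⟨z', hCX hz'.1, hz'.2⟩

theorem IsCD.comp {F : Set (M.D (Ty.prod a b))} {G : Set (M.D (Ty.prod b c))} (hF : M.IsCD F)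
    (hG : M.IsCD G) :
    M.IsCD {z : M.D (Ty.prod a c) | ∃ y, M.pair (M.fst z) y ∈ F ∧ M.pair y (M.snd z) ∈ G} := by
  have hFG := (hF.preimage (a := Ty.prod a (Ty.prod b c)) (fun p : Std a × Std b × Std c =>
    (p.1, p.2.1))).inter (hG.preimage (a := Ty.prod a (Ty.prod b c)) Prod.snd)
  convert hFG.image (b := Ty.prod a c) (fun p : Std a × Std b × Std c => (p.1, p.2.2)) using 1
  ext z
  simp only [Set.mem_ofPred_eq, Set.mem_image, Set.mem_inter_iff, Set.mem_preimage,
    starFun_fst_fst_snd, starFun_fst_snd_snd]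
  constructor
  · rintro ⟨y, hF, hG⟩
    refine ⟨M.pair (M.fst z) (M.pair y (M.snd z)), ⟨?_, ?_⟩, ?_⟩
    · rwa [fst_pair, snd_pair, fst_pair]
    · exact Set.mem_of_eq_of_mem (M.snd_pair (M.fst z) (M.pair y (M.snd z))) hG
    · rw [fst_pair, snd_pair, snd_pair, pair_fst_snd]
  · rintro ⟨t, ⟨hF, hG⟩, rfl⟩
    rw [fst_pair, snd_pair]
    exact ⟨M.fst (M.snd t), hF, (M.pair_fst_snd (M.snd t)).symm ▸ hG⟩

theorem IsCD.prodSet {X : Set (M.D a)} {Y : Set (M.D b)} (hX : M.IsCD X) (hY : M.IsCD Y) :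
    M.IsCD (M.prodSet X Y) := by
  convert (hX.preimage (a := Ty.prod a b) Prod.fst).inter
    (hY.preimage (a := Ty.prod a b) Prod.snd) using 1
  ext z
  constructor
  · rintro ⟨x, hx, y, hy, rfl⟩
    exact ⟨((M.fst_pair x y).symm ▸ hx : M.fst _ ∈ X), ((M.snd_pair x y).symm ▸ hy : M.snd _ ∈ Y)⟩
  · rintro ⟨hz₁, hz₂⟩
    exact ⟨M.fst z, hz₁, M.snd z, hz₂, (M.pair_fst_snd z).symm⟩

theorem isCD_stdNat : M.IsCD M.stdNat := by
  rw [stdNat, ← Set.iUnion_singleton_eq_range]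
  exact IsCD.iUnion fun n => (isInternal_singleton _).isCD

theorem cdLe_of_injOn {X : Set (M.D a)} {Y : Set (M.D b)} (F : M.D a → M.D b)
    (hmaps : Set.MapsTo F X Y) (hinj : Set.InjOn F X)
    (hgraph : M.IsCD {z : M.D (Ty.prod a b) | M.fst z ∈ X ∧ M.snd z = F (M.fst z)}) :
    M.CDLe X Y := by
  refine ⟨hmaps.restrict F X Y, (hmaps.restrict_inj).2 hinj, ?_⟩
  rw [IsCDMap]
  convert hgraph using 1
  ext z
  constructor
  · rintro ⟨x, rfl⟩
    simp only [Set.mem_ofPred_eq, fst_pair, snd_pair, Set.MapsTo.val_restrict_apply, x.2, and_self]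
  · rintro ⟨hz, h⟩
    exact ⟨⟨M.fst z, hz⟩, by rw [Set.MapsTo.val_restrict_apply, ← h, pair_fst_snd]⟩

theorem cdLe_of_starFun {X : Set (M.D a)} {Y : Set (M.D b)} (hX : M.IsCD X) (f : Std a → Std b)
    (hmaps : Set.MapsTo (M.starFun f) X Y) (hinj : Set.InjOn (M.starFun f) X) :
    M.CDLe X Y := by
  refine cdLe_of_injOn (M.starFun f) hmaps hinj ?_
  convert (hX.preimage (a := Ty.prod a b) Prod.fst).inter
    (isInternal_starFun_eq (a := Ty.prod a b) Prod.snd fun p => f p.1).isCD using 1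
  ext z
  refine and_congr_right fun _ => ?_
  rw [fst, starFun_starFun]
  rfl

theorem cdLe_of_subset {X Y : Set (M.D a)} (hX : M.IsCD X) (h : X ⊆ Y) : M.CDLe X Y :=
  cdLe_of_starFun hX (fun t => t) (fun x hx => (M.starFun_id x).symm ▸ h hx) fun x _ y _ hxy => by
    rwa [starFun_id, starFun_id] at hxy

theorem CDLe.trans {X : Set (M.D a)} {Y : Set (M.D b)} {Z : Set (M.D c)} (hXY : M.CDLe X Y)
    (hYZ : M.CDLe Y Z) : M.CDLe X Z := by
  obtain ⟨f, hf, hfCD⟩ := hXY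
  obtain ⟨g, hg, hgCD⟩ := hYZ
  refine ⟨g ∘ f, hg.comp hf, ?_⟩
  rw [IsCDMap]
  convert hfCD.comp hgCD using 1
  ext z
  constructor
  · rintro ⟨x, rfl⟩
    rw [Set.mem_ofPred_eq, fst_pair, snd_pair]
    exact ⟨f x, ⟨x, rfl⟩, f x, rfl⟩
  · rintro ⟨y, ⟨x, hx⟩, y', hy'⟩
    obtain ⟨hzx, rfl⟩ := M.pair_injective hx
    obtain ⟨hyy', hzy⟩ := M.pair_injective hy'
    obtain rfl := Subtype.ext hyy'
    exact ⟨x, by rw [← M.pair_fst_snd z, hzx, hzy]; rfl⟩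

end CountablyDetermined

section HypernaturalNumbers

variable {M : NonstandardUniverse.{u}} {x y z : M.HNat} {U V : Set M.HNat}

theorem lt_iff_not_le : M.lt x y ↔ ¬ M.le y x := by
  obtain ⟨e, t, f, g, rfl, rfl⟩ := M.exists_starFun₂ x y
  simp only [lt_starFun, le_starFun, ← Ultrafilter.eventually_not, not_le]

theorem le_of_lt (h : M.lt x y) : M.le x y := by
  obtain ⟨e, t, f, g, rfl, rfl⟩ := M.exists_starFun₂ x y
  rw [lt_starFun] at h
  rw [le_starFun]
  exact h.mono fun _ => Nat.le_of_lt

theorem le_refl (x : M.HNat) : M.le x x := by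
  obtain ⟨e, t, f, -, rfl, -⟩ := M.exists_starFun₂ x x
  rw [le_starFun]
  exact Eventually.of_forall fun _ => le_rfl

theorem le_total (x y : M.HNat) : M.le x y ∨ M.le y x :=
  (em (M.le y x)).symm.imp_left fun h => le_of_lt (lt_iff_not_le.2 h)

theorem le_trans (hxy : M.le x y) (hyz : M.le y z) : M.le x z := by
  obtain ⟨e, t, f, g, h, rfl, rfl, rfl⟩ := M.exists_starFun₃ x y z
  rw [le_starFun] at hxy hyz ⊢
  exact (hxy.and hyz).mono fun _ hs => hs.1.trans hs.2

theorem le_star_star {m n : ℕ} :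
    M.le (M.star (a := Ty.nat) m) (M.star (a := Ty.nat) n) ↔ m ≤ n := by
  rw [le, starRel, ← star_pair, mem_star_star]
  rfl

theorem star_zero_le (x : M.HNat) : M.le (M.star (a := Ty.nat) (0 : ℕ)) x := by
  obtain ⟨e, t, f, -, rfl, -⟩ := M.exists_starFun₂ x x
  rw [← M.starFun_const (b := Ty.nat) _ t, le_starFun]
  exact Eventually.of_forall fun s => Nat.zero_le _

theorem mul_le_mul_right (hxy : M.le x y) (z : M.HNat) : M.le (M.mul x z) (M.mul y z) := by
  obtain ⟨e, t, f, g, h, rfl, rfl, rfl⟩ := M.exists_starFun₃ x y z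
  rw [le_starFun] at hxy
  rw [mul_starFun, mul_starFun, le_starFun]
  exact hxy.mono fun s hs => Nat.mul_le_mul_right _ hs

theorem mul_star_zero (x : M.HNat) :
    M.mul x (M.star (a := Ty.nat) (0 : ℕ)) = M.star (a := Ty.nat) (0 : ℕ) := by
  obtain ⟨e, t, f, -, rfl, -⟩ := M.exists_starFun₂ x x
  rw [mul_starFun_star, ← M.starFun_const (b := Ty.nat) _ t]
  rfl

theorem mul_star_one (x : M.HNat) : M.mul x (M.star (a := Ty.nat) (1 : ℕ)) = x := by
  obtain ⟨e, t, f, -, rfl, -⟩ := M.exists_starFun₂ x x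
  rw [mul_starFun_star]
  exact congrArg (M.starFun (b := Ty.nat) · t) (funext fun s => mul_one (f s))

theorem mul_star_add (x : M.HNat) (m n : ℕ) :
    M.mul x (M.star (a := Ty.nat) (m + n : ℕ)) =
      M.add (M.mul x (M.star (a := Ty.nat) m)) (M.mul x (M.star (a := Ty.nat) n)) := by
  obtain ⟨e, t, f, -, rfl, -⟩ := M.exists_starFun₂ x x
  rw [mul_starFun_star, mul_starFun_star, mul_starFun_star, add_starFun]
  exact congrArg (M.starFun (b := Ty.nat) · t) (funext fun s => mul_add (f s) m n)

theorem mul_star_mul_star (x : M.HNat) (m n : ℕ) :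
    M.mul (M.mul x (M.star (a := Ty.nat) m)) (M.star (a := Ty.nat) n) =
      M.mul x (M.star (a := Ty.nat) (m * n : ℕ)) := by
  obtain ⟨e, t, f, -, rfl, -⟩ := M.exists_starFun₂ x x
  rw [mul_starFun_star, mul_starFun_star, mul_starFun_star]
  exact congrArg (M.starFun (b := Ty.nat) · t) (funext fun s => mul_assoc (f s) m n)

theorem add_le_mul_two (hxz : M.le x z) (hyz : M.le y z) :
    M.le (M.add x y) (M.mul z (M.star (a := Ty.nat) (2 : ℕ))) := by
  obtain ⟨e, t, f, g, h, rfl, rfl, rfl⟩ := M.exists_starFun₃ x y z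
  rw [le_starFun] at hxz hyz
  rw [add_starFun, mul_starFun_star, le_starFun]
  exact (hxz.and hyz).mono fun s hs => by omega

theorem star_add_star (m n : ℕ) :
    M.add (M.star (a := Ty.nat) m) (M.star (a := Ty.nat) n) = M.star (a := Ty.nat) (m + n : ℕ) := by
  rw [add]
  exact (congrArg _ (M.star_pair (a := Ty.nat) (b := Ty.nat) m n).symm).trans
    (M.starFun_star (a := Ty.prod Ty.nat Ty.nat) (b := Ty.nat) _ _)

theorem ultra_le_atTop (hx : x ∉ M.stdNat) : (M.ultra x : Filter ℕ) ≤ atTop := by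
  rw [← Nat.cofinite_eq_atTop]
  refine (M.ultra x).le_cofinite_or_eq_pure.resolve_right ?_
  rintro ⟨n, hn⟩
  refine hx ⟨n, ?_⟩
  change M.star (a := Ty.nat) n = x
  rw [← M.starFun_const (b := Ty.nat) n x]
  refine Eq.trans ?_ (M.starFun_id x)
  rw [starFun_eq_starFun_iff, hn]
  rfl

theorem tendsto_atTop_of_notMem_stdNat {a : Ty} {m : Std a → ℕ} {t : M.D a}
    (hx : M.starFun (b := Ty.nat) m t ∉ M.stdNat) : Tendsto m (M.ultra t) atTop := by
  have := ultra_le_atTop hx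
  rwa [ultra_starFun] at this

theorem isCut_stdNat : M.IsCut M.stdNat := by
  rintro _ ⟨n, rfl⟩ y (hy : M.le y (M.star (a := Ty.nat) n))
  by_contra hy'
  obtain ⟨e, t, f, -, rfl, -⟩ := M.exists_starFun₂ y y
  rw [← M.starFun_const (b := Ty.nat) n t, le_starFun] at hy
  obtain ⟨s, hs, hs'⟩ :=
    (hy.and ((tendsto_atTop_of_notMem_stdNat hy').eventually_gt_atTop n)).exists
  exact hs.not_gt hs'

theorem isAdditive_stdNat : M.IsAdditive M.stdNat := by
  rintro _ ⟨m, rfl⟩ _ ⟨n, rfl⟩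
  exact ⟨m + n, (star_add_star m n).symm⟩

theorem IsCut.stdNat_subset (hU : M.IsCut U) (hinf : U.Infinite) : M.stdNat ⊆ U := by
  rintro _ ⟨n, rfl⟩
  by_contra hn
  have hUn : ∀ x ∈ U, M.le x (M.star (a := Ty.nat) n) := fun x hx =>
    (le_total _ _).resolve_right fun h => hn (hU x hx _ h)
  refine hinf (((Set.finite_Iic n).image fun k : ℕ => M.star (a := Ty.nat) k).subset fun x hx => ?_)
  obtain ⟨k, rfl⟩ := isCut_stdNat _ ⟨n, rfl⟩ x (hUn x hx)
  exact ⟨k, le_star_star.1 (hUn _ hx), rfl⟩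

theorem mem_mulNat : y ∈ M.mulNat U ↔
    ∃ x ∈ U, ∃ n : ℕ, M.le y (M.mul x (M.star (a := Ty.nat) n)) := by
  simp only [mulNat, Set.mem_iUnion, Set.mem_ofPred_eq, exists_prop]
  rw [exists_comm]
  simp only [exists_and_left]

theorem mem_mulNat_singleton : y ∈ M.mulNat {x} ↔
    ∃ n : ℕ, M.le y (M.mul x (M.star (a := Ty.nat) n)) := by
  simp only [mem_mulNat, Set.mem_singleton_iff, exists_eq_left]

theorem subset_mulNat (U : Set M.HNat) : U ⊆ M.mulNat U := fun x hx =>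
  mem_mulNat.2 ⟨x, hx, 1, by rw [mul_star_one]; exact le_refl x⟩

theorem mulNat_mono (h : U ⊆ V) : M.mulNat U ⊆ M.mulNat V := fun _ hy =>
  have ⟨x, hx, n, hn⟩ := mem_mulNat.1 hy
  mem_mulNat.2 ⟨x, h hx, n, hn⟩

theorem mulNat_mulNat (U : Set M.HNat) : M.mulNat (M.mulNat U) = M.mulNat U := by
  refine (subset_mulNat _).antisymm' fun z hz => ?_
  obtain ⟨y, hy, n, hzy⟩ := mem_mulNat.1 hz
  obtain ⟨x, hx, m, hyx⟩ := mem_mulNat.1 hy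
  refine mem_mulNat.2 ⟨x, hx, m * n, ?_⟩
  rw [← mul_star_mul_star]
  exact le_trans hzy (mul_le_mul_right hyx _)

theorem isCut_mulNat (U : Set M.HNat) : M.IsCut (M.mulNat U) := fun _ hx _ hyx =>
  have ⟨z, hz, n, hxz⟩ := mem_mulNat.1 hx
  mem_mulNat.2 ⟨z, hz, n, le_trans hyx hxz⟩

theorem IsCut.mul_star_mem (hU : M.IsCut U) (hadd : M.IsAdditive U) (hx : x ∈ U) (n : ℕ) :
    M.mul x (M.star (a := Ty.nat) n) ∈ U := by
  induction n with
  | zero => exact hU x hx _ ((mul_star_zero x).symm ▸ star_zero_le x)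
  | succ n ih => exact mul_star_add x n 1 ▸ hadd _ ih _ ((mul_star_one x).symm ▸ hx)

theorem IsCut.mulNat_eq (hU : M.IsCut U) (hadd : M.IsAdditive U) : M.mulNat U = U :=
  (subset_mulNat U).antisymm' fun _ hy =>
    have ⟨_, hx, n, hyx⟩ := mem_mulNat.1 hy
    hU _ (hU.mul_star_mem hadd hx n) _ hyx

theorem notMem_stdNat_of_notMem_mulNat (hy : y ∉ M.mulNat {x}) (h : x ∉ M.stdNat ∨ y ∉ M.stdNat) :
    y ∉ M.stdNat := by
  refine h.elim (fun hx hy' => hx ?_) id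
  refine isCut_stdNat y hy' x ((le_total x y).resolve_right fun hyx => hy ?_)
  exact isCut_mulNat _ x (subset_mulNat _ (Set.mem_singleton x)) y hyx

end HypernaturalNumbers

section StandardPart

variable {M : NonstandardUniverse.{u}} {a : Ty} {α : M.HReal} {r s : ℝ} {x y : M.HNat}

theorem near_star_iff :
    M.Near α (M.star (a := Ty.real) r) ↔ Tendsto id (M.ultra α : Filter ℝ) (𝓝 r) := by
  have hdist : M.starFun (a := Ty.prod Ty.real Ty.real) (b := Ty.real)
      (fun p : ℝ × ℝ => |p.1 - p.2|) (M.pair α (M.star (a := Ty.real) r)) =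
      M.starFun (a := Ty.real) (b := Ty.real) (fun s : ℝ => |s - r|) α := by
    have hpair := M.pair_starFun (a := Ty.real) (b := Ty.real) (c := Ty.real) (fun s => s)
      (fun _ => r) α
    rw [M.starFun_id (a := Ty.real), M.starFun_const (a := Ty.real) (b := Ty.real)] at hpair
    rw [hpair]
    exact M.starFun_starFun (b := Ty.prod Ty.real Ty.real) (c := Ty.real) _ _ _
  rw [Near, hdist, Metric.tendsto_nhds]
  refine forall₂_congr fun ε _ => ?_
  rw [← M.starFun_const (b := Ty.real) ε α]
  exact M.starRel_starFun (b := Ty.real) (c := Ty.real) _ _ _ α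

theorem near_ratio_starFun {f g : Std a → ℕ} {t : M.D a} :
    M.Near (M.ratio (M.starFun (b := Ty.nat) f t) (M.starFun (b := Ty.nat) g t))
      (M.star (a := Ty.real) r) ↔ Tendsto (fun i => (f i : ℝ) / g i) (M.ultra t) (𝓝 r) := by
  rw [near_star_iff, ratio_starFun, ultra_starFun]
  rfl

theorem Near.unique (hr : M.Near α (M.star (a := Ty.real) r))
    (hs : M.Near α (M.star (a := Ty.real) s)) : r = s :=
  tendsto_nhds_unique (near_star_iff.1 hr) (near_star_iff.1 hs)

theorem Near.st_eq (hr : M.Near α (M.star (a := Ty.real) r)) : M.st α = r := by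
  have h : ∃ r : ℝ, M.Near α (M.star (a := Ty.real) r) := ⟨r, hr⟩
  rw [st, dif_pos h, h.choose_spec.unique hr]

theorem st_lt_top_iff : M.st α < ⊤ ↔ ∃ r : ℝ, M.Near α (M.star (a := Ty.real) r) := by
  refine ⟨fun h => ?_, fun ⟨r, hr⟩ => hr.st_eq ▸ EReal.coe_lt_top r⟩
  by_contra hα
  exact h.ne (dif_neg hα)

theorem isCD_near (A : Set ℝ) :
    M.IsCD {α : M.HReal | ∃ r ∈ A, M.Near α (M.star (a := Ty.real) r)} := by
  refine isCD_of_forall (fun q : ℚ => {α | ∀ᶠ s : ℝ in (M.ultra α : Filter ℝ), s < q})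
    (fun q => isInternal_eventually (a := Ty.real) fun s : ℝ => s < q) ?_
  rintro α β hαβ ⟨r, hr, hα⟩
  replace hαβ (q : ℚ) : (∀ᶠ s : ℝ in (M.ultra α : Filter ℝ), s < q) ↔
      ∀ᶠ s : ℝ in (M.ultra β : Filter ℝ), s < q := hαβ q
  refine ⟨r, hr, near_star_iff.2 ?_⟩
  have hα' := tendsto_order.1 (near_star_iff.1 hα)
  refine tendsto_order.2 ⟨fun s hs => ?_, fun s hs => ?_⟩
  · obtain ⟨q, hsq, hqr⟩ := exists_rat_btwn hs
    have hq : ¬ ∀ᶠ s : ℝ in (M.ultra β : Filter ℝ), s < q := fun hβ =>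
      have ⟨_, h₁, h₂⟩ := (((hαβ q).2 hβ).and (hα'.1 q hqr)).exists
      lt_asymm h₁ h₂
    rw [← Ultrafilter.eventually_not] at hq
    exact hq.mono fun t ht => hsq.trans_le (not_lt.1 ht)
  · obtain ⟨q, hrq, hqs⟩ := exists_rat_btwn hs
    exact ((hαβ q).1 (hα'.2 q hrq)).mono fun t ht => ht.trans hqs

theorem exists_near_ratio (h : y ∈ M.mulNat {x}) :
    ∃ r : ℝ, M.Near (M.ratio y x) (M.star (a := Ty.real) r) := by
  obtain ⟨n, hn⟩ := mem_mulNat_singleton.1 h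
  obtain ⟨e, t, f, g, rfl, rfl⟩ := M.exists_starFun₂ y x
  rw [mul_starFun_star, le_starFun] at hn
  have hbdd : ∀ᶠ i in M.ultra t, (f i : ℝ) / g i ∈ Set.Icc (0 : ℝ) n := hn.mono fun i hi =>
    ⟨by positivity, div_le_of_le_mul₀ (by positivity) (by positivity)
      (by rw [mul_comm]; exact_mod_cast hi)⟩
  obtain ⟨r, -, hr⟩ := isCompact_Icc.ultrafilter_le_nhds
    ((M.ultra t).map fun i => (f i : ℝ) / g i) (le_principal_iff.2 hbdd)
  exact ⟨r, near_ratio_starFun.2 hr⟩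

theorem eventually_pos_of_ne_zero {g : Std a → ℕ} {t : M.D a}
    (h : M.starFun (b := Ty.nat) g t ≠ M.star (a := Ty.nat) (0 : ℕ)) :
    ∀ᶠ i in M.ultra t, 0 < g i := by
  rw [← M.starFun_const (b := Ty.nat) _ t, ne_eq, starFun_eq_starFun_iff,
    ← Ultrafilter.eventually_not] at h
  exact h.mono fun i hi => Nat.pos_of_ne_zero hi

theorem Near.mem_mulNat (hx : x ≠ M.star (a := Ty.nat) (0 : ℕ))
    (h : M.Near (M.ratio y x) (M.star (a := Ty.real) r)) : y ∈ M.mulNat {x} := by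
  obtain ⟨n, hn⟩ := exists_nat_gt r
  refine mem_mulNat_singleton.2 ⟨n, ?_⟩
  obtain ⟨e, t, f, g, rfl, rfl⟩ := M.exists_starFun₂ y x
  rw [mul_starFun_star, le_starFun]
  filter_upwards [eventually_pos_of_ne_zero hx, (near_ratio_starFun.1 h).eventually_lt_const hn]
    with i hi hlt
  rw [div_lt_iff₀' (by exact_mod_cast hi)] at hlt
  exact_mod_cast hlt.le

theorem Near.mem_mulNat_iff_pos (hx : x ≠ M.star (a := Ty.nat) (0 : ℕ))
    (h : M.Near (M.ratio y x) (M.star (a := Ty.real) r)) : x ∈ M.mulNat {y} ↔ 0 < r := by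
  obtain ⟨e, t, f, g, rfl, rfl⟩ := M.exists_starFun₂ y x
  have hg := eventually_pos_of_ne_zero hx
  rw [near_ratio_starFun] at h
  simp only [mem_mulNat_singleton, mul_starFun_star, le_starFun]
  constructor
  · rintro ⟨n, hn⟩
    have hpos : (0 : ℝ) < 1 / (n + 1) := by positivity
    refine hpos.trans_le (ge_of_tendsto h ?_)
    filter_upwards [hg, hn] with i hi hle
    rw [div_le_div_iff₀ (by positivity) (by exact_mod_cast hi), one_mul]
    exact_mod_cast hle.trans (Nat.mul_le_mul_left _ n.le_succ)
  · intro hr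
    obtain ⟨n, hn⟩ := exists_nat_one_div_lt hr
    refine ⟨n + 1, ?_⟩
    filter_upwards [hg, h.eventually_const_lt hn] with i hi hlt
    rw [div_lt_div_iff₀ (by positivity) (by exact_mod_cast hi), one_mul] at hlt
    exact_mod_cast hlt.le

theorem st_ratio_pos_lt_top_iff (hy : y ≠ M.star (a := Ty.nat) (0 : ℕ)) :
    0 < M.st (M.ratio x y) ∧ M.st (M.ratio x y) < ⊤ ↔
      x ∈ M.mulNat {y} ∧ y ∈ M.mulNat {x} := by
  rw [st_lt_top_iff]
  constructor
  · rintro ⟨hpos, r, hr⟩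
    rw [hr.st_eq] at hpos
    exact ⟨hr.mem_mulNat hy, (hr.mem_mulNat_iff_pos hy).2 (EReal.coe_pos.1 hpos)⟩
  · rintro ⟨hxy, hyx⟩
    obtain ⟨r, hr⟩ := exists_near_ratio hxy
    exact ⟨hr.st_eq ▸ EReal.coe_pos.2 ((hr.mem_mulNat_iff_pos hy).1 hyx), r, hr⟩

end StandardPart

section RationalShift

theorem exists_injective_add_rat_mem_Ioo (c : ℝ) :
    ∃ e : ℚ → ℚ, Function.Injective e ∧ ∀ p, c + e p ∈ Set.Ioo (0 : ℝ) 1 := by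
  obtain ⟨p₁, hp₁, hp₁'⟩ := exists_rat_btwn (show -c < 1 - c by linarith)
  obtain ⟨p₂, hp₁₂, hp₂⟩ := exists_rat_btwn hp₁'
  have hinf : Infinite (Set.Ioo p₁ p₂) := (Set.Ioo_infinite (by exact_mod_cast hp₁₂)).to_subtype
  let i : ℚ ↪ Set.Ioo p₁ p₂ := (Encodable.encode' ℚ).trans (Infinite.natEmbedding _)
  refine ⟨fun p => i p, Subtype.val_injective.comp i.injective, fun p => ?_⟩
  have hlt : (p₁ : ℝ) < (i p : ℚ) := by exact_mod_cast (i p).2.1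
  have hgt : ((i p : ℚ) : ℝ) < p₂ := by exact_mod_cast (i p).2.2
  constructor <;> linarith

theorem exists_rat_coset_representative :
    ∃ (rep : ℝ → ℝ) (p : ℝ → ℚ), (∀ r, rep r = r + p r) ∧ ∀ r (s : ℚ), rep (r + s) = rep r := by
  let H : AddSubgroup ℝ := (Rat.castHom ℝ).toAddMonoidHom.range
  have hp (r : ℝ) : ∃ p : ℚ, (r : ℝ ⧸ H).out = r + p := by
    obtain ⟨⟨_, p, rfl⟩, hp⟩ := QuotientAddGroup.mk_out_eq_add H r
    exact ⟨p, hp⟩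
  choose p hp using hp
  refine ⟨fun r => (r : ℝ ⧸ H).out, p, hp, fun r s => ?_⟩
  exact congrArg Quotient.out (QuotientAddGroup.mk_add_of_mem r ⟨s, rfl⟩)

theorem exists_injective_add_rat :
    ∃ q : ℝ → ℚ, Function.Injective (fun r => r + (q r : ℝ)) ∧
      ∀ r, r + q r ∈ Set.Ioo (0 : ℝ) 1 := by
  obtain ⟨rep, p, hp, hrep⟩ := exists_rat_coset_representative
  choose e he hmem using exists_injective_add_rat_mem_Ioo
  have hsum (r : ℝ) : r + (p r + e (rep r) (p r) : ℚ) = rep r + e (rep r) (p r) := by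
    rw [Rat.cast_add, ← add_assoc, ← hp]
  refine ⟨fun r => p r + e (rep r) (p r), fun r s hrs => ?_, fun r => ?_⟩
  · have hrep_eq : rep r = rep s := by simpa only [hrep] using congrArg rep hrs
    simp only [hsum] at hrs
    rw [hrep_eq, add_right_inj, Rat.cast_inj] at hrs
    rw [hp, hp, he _ hrs] at hrep_eq
    exact add_right_cancel hrep_eq
  · rw [hsum]
    exact hmem _ _

theorem tendsto_floor_div {ι : Type*} {l : Filter ι} {u v : ι → ℝ} {r : ℝ}
    (hv : Tendsto v l atTop) (huv : Tendsto (fun i => u i / v i) l (𝓝 r)) (hr : 0 < r) :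
    Tendsto (fun i => (⌊u i⌋₊ : ℝ) / v i) l (𝓝 r) := by
  have hlower : Tendsto (fun i => u i / v i - (v i)⁻¹) l (𝓝 r) := by
    simpa only [sub_zero, Function.comp_def] using huv.sub (tendsto_inv_atTop_zero.comp hv)
  refine tendsto_of_tendsto_of_tendsto_of_le_of_le' hlower huv ?_ ?_
  all_goals filter_upwards [hv.eventually_gt_atTop 0, huv.eventually_const_lt hr] with i hi hpos
  · rw [← one_div, ← sub_div]
    gcongr
    exact (Nat.sub_one_lt_floor _).le
  · gcongr
    exact Nat.floor_le ((div_pos_iff_of_pos_right hi).1 hpos).le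

/-- The number `k` moved by the fraction `q` of `m` and rounded down; the value is `0` where this
would be negative. -/
noncomputable def shift (q : ℚ) (k m : ℕ) : ℕ := ⌊(k : ℝ) + q * m⌋₊

section Asymptotics

variable {ι : Type*} {l : Filter ι} {k k' m : ι → ℕ} {r : ℝ} {q : ℚ}

theorem tendsto_natCast_add_mul_div (hm : Tendsto m l atTop)
    (hk : Tendsto (fun i => (k i : ℝ) / m i) l (𝓝 r)) :
    Tendsto (fun i => ((k i : ℝ) + q * m i) / m i) l (𝓝 (r + q)) := by
  refine (hk.add_const (q : ℝ)).congr' ?_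
  filter_upwards [hm.eventually_gt_atTop 0] with i hi
  have : (m i : ℝ) ≠ 0 := by exact_mod_cast hi.ne'
  field_simp

theorem tendsto_shift_div (hm : Tendsto m l atTop)
    (hk : Tendsto (fun i => (k i : ℝ) / m i) l (𝓝 r)) (hr : 0 < r + q) :
    Tendsto (fun i => (shift q (k i) (m i) : ℝ) / m i) l (𝓝 (r + q)) :=
  tendsto_floor_div (tendsto_natCast_atTop_atTop.comp hm) (tendsto_natCast_add_mul_div hm hk) hr

theorem eventually_shift_eq (hm : Tendsto m l atTop)
    (hk : Tendsto (fun i => (k i : ℝ) / m i) l (𝓝 r)) (hr : 0 < r + q) :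
    ∀ᶠ i in l, (shift q (k i) (m i) : ℤ) = k i + ⌊(q : ℝ) * m i⌋ := by
  filter_upwards [hm.eventually_gt_atTop 0,
    (tendsto_natCast_add_mul_div hm hk).eventually_const_lt hr] with i hi hpos
  rw [div_pos_iff_of_pos_right (by exact_mod_cast hi)] at hpos
  rw [shift, Int.natCast_floor_eq_floor hpos.le, Int.floor_natCast_add]

end Asymptotics

variable {M : NonstandardUniverse.{u}} {a : Ty} {x y z : M.HNat} {q : ℚ} {r : ℝ}

/-- The hypernatural `y` moved by the fraction `q` of `x`: the internal version of `shift`. -/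
noncomputable def hshift (M : NonstandardUniverse.{u}) (q : ℚ) (y x : M.HNat) : M.HNat :=
  M.starFun (a := Ty.prod Ty.nat Ty.nat) (b := Ty.nat) (fun p : ℕ × ℕ => shift q p.1 p.2)
    (M.pair y x)

theorem hshift_starFun (q : ℚ) (f g : Std a → ℕ) (t : M.D a) :
    M.hshift q (M.starFun (b := Ty.nat) f t) (M.starFun (b := Ty.nat) g t) =
      M.starFun (b := Ty.nat) (fun s => shift q (f s) (g s)) t := by
  rw [hshift, pair_starFun]
  exact M.starFun_starFun (b := Ty.prod Ty.nat Ty.nat) (c := Ty.nat) _ _ _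

theorem isInternal_hshift (q : ℚ) (x : M.HNat) :
    M.IsInternal {z : M.D (Ty.prod Ty.nat Ty.nat) | M.snd z = M.hshift q (M.fst z) x} := by
  convert isInternal_starRel (M := M) (a := Ty.prod Ty.nat Ty.nat) (b := Ty.nat)
    (fun (s : ℕ × ℕ) (m : ℕ) => s.2 = shift q s.1 m) x using 1
  ext z
  obtain ⟨e, t, f, g, rfl, rfl⟩ := M.exists_starFun₂ z x
  rw [Set.mem_ofPred_eq, Set.mem_ofPred_eq, fst, snd, starFun_starFun, starFun_starFun,
    hshift_starFun, starFun_eq_starFun_iff, starRel_starFun]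

theorem isCD_near_ratio (A : Set ℝ) (x : M.HNat) :
    M.IsCD {y : M.HNat | ∃ r ∈ A, M.Near (M.ratio y x) (M.star (a := Ty.real) r)} :=
  ((isCD_near A).preimage (a := Ty.prod Ty.nat Ty.nat) (b := Ty.real)
    fun p : ℕ × ℕ => (p.1 : ℝ) / p.2).preimage_pair (a := Ty.nat) x

theorem Near.ratio_hshift (hx : x ∉ M.stdNat)
    (h : M.Near (M.ratio y x) (M.star (a := Ty.real) r)) (hr : 0 < r + q) :
    M.Near (M.ratio (M.hshift q y x) x) (M.star (a := Ty.real) (r + q : ℝ)) := by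
  obtain ⟨e, t, f, g, rfl, rfl⟩ := M.exists_starFun₂ y x
  rw [hshift_starFun]
  rw [near_ratio_starFun] at h ⊢
  exact tendsto_shift_div (tendsto_atTop_of_notMem_stdNat hx) h hr

theorem eq_of_hshift_eq (hx : x ∉ M.stdNat)
    (hy : M.Near (M.ratio y x) (M.star (a := Ty.real) r))
    (hz : M.Near (M.ratio z x) (M.star (a := Ty.real) r)) (hr : 0 < r + q)
    (h : M.hshift q y x = M.hshift q z x) : y = z := by
  obtain ⟨e, t, f, f', g, rfl, rfl, rfl⟩ := M.exists_starFun₃ y z x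
  rw [hshift_starFun, hshift_starFun, starFun_eq_starFun_iff] at h
  rw [near_ratio_starFun] at hy hz
  have hg := tendsto_atTop_of_notMem_stdNat hx
  rw [starFun_eq_starFun_iff]
  filter_upwards [h, eventually_shift_eq hg hy hr, eventually_shift_eq hg hz hr] with i hi h₁ h₂
  rw [hi, h₂] at h₁
  exact_mod_cast (add_right_cancel h₁).symm

theorem Near.lt_of_lt_one (hx : x ∉ M.stdNat)
    (h : M.Near (M.ratio y x) (M.star (a := Ty.real) r)) (hr : r < 1) : M.lt y x := by
  obtain ⟨e, t, f, g, rfl, rfl⟩ := M.exists_starFun₂ y x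
  rw [lt_starFun]
  filter_upwards [(near_ratio_starFun.1 h).eventually_lt_const hr,
    (tendsto_atTop_of_notMem_stdNat hx).eventually_gt_atTop 0] with i hi hpos
  rw [div_lt_one (by exact_mod_cast hpos)] at hi
  exact_mod_cast hi

theorem cdLe_mulNat_singleton_below (hx : x ∉ M.stdNat) :
    M.CDLe (M.mulNat {x}) (M.below x) := by
  obtain ⟨q, hinj, hmem⟩ := exists_injective_add_rat
  choose! ρ hρ using fun y (hy : y ∈ M.mulNat {x}) => exists_near_ratio hy
  have hlim (y : M.HNat) (hy : y ∈ M.mulNat {x}) := (hρ y hy).ratio_hshift hx (hmem (ρ y)).1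
  have hx₀ : x ≠ M.star (a := Ty.nat) (0 : ℕ) := fun h => hx ⟨0, h.symm⟩
  refine cdLe_of_injOn (fun y => M.hshift (q (ρ y)) y x)
    (fun y hy => (hlim y hy).lt_of_lt_one hx (hmem _).2) (fun y hy z hz hyz => ?_) ?_
  · dsimp only at hyz
    have hρ_eq : ρ y = ρ z := hinj ((hlim y hy).unique (hyz ▸ hlim z hz))
    rw [hρ_eq] at hyz
    exact eq_of_hshift_eq hx (hρ_eq ▸ hρ y hy) (hρ z hz) (hmem _).1 hyz
  · convert IsCD.iUnion fun p : ℚ => ((isCD_near_ratio (q ⁻¹' {p}) x).preimage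
      (a := Ty.prod Ty.nat Ty.nat) Prod.fst).inter (isInternal_hshift p x).isCD using 1
    ext z
    rw [Set.mem_iUnion]
    constructor
    · rintro ⟨hz, h⟩
      exact ⟨q (ρ (M.fst z)), ⟨ρ (M.fst z), rfl, hρ _ hz⟩, h⟩
    · rintro ⟨p, ⟨r, rfl, hr⟩, h⟩
      have hz : M.fst z ∈ M.mulNat {x} := hr.mem_mulNat hx₀
      exact ⟨hz, (hρ _ hz).unique hr ▸ h⟩

end RationalShift

section Counting

variable {M : NonstandardUniverse.{u}} {a b : Ty} {x y v : M.HNat} {U V : Set M.HNat}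

theorem exists_lt_forall_ne (f : ℕ → ℕ → ℕ) {N v : ℕ} (hv : 2 * N < v) :
    ∃ w < v, ∀ n < N, ∀ u, u * 2 ^ (n + 2) < v → w ≠ f n u := by
  let T : Finset ℕ := (Finset.range N).biUnion fun n =>
    (Finset.range (v / 2 ^ (n + 2) + 1)).image (f n)
  have hcard : T.card < (Finset.range v).card := calc
    T.card ≤ ∑ n ∈ Finset.range N, (v / 2 ^ (n + 2) + 1) :=
      Finset.card_biUnion_le.trans <| Finset.sum_le_sum fun n _ =>
        Finset.card_image_le.trans (Finset.card_range _).le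
    _ = ∑ n ∈ Finset.range N, v / 4 / 2 ^ n + N := by
      simp only [Finset.sum_add_distrib, Finset.sum_const, Finset.card_range, smul_eq_mul, mul_one,
        Nat.div_div_eq_div_mul, pow_add, mul_comm, Nat.reducePow]
    _ ≤ v / 4 * 2 + N := Nat.add_le_add_right ((Nat.geom_sum_le le_rfl _ _).trans_eq (by simp)) N
    _ < (Finset.range v).card := by rw [Finset.card_range]; lia
  obtain ⟨w, hw, hwT⟩ := Finset.exists_mem_notMem_of_card_lt_card hcard
  refine ⟨w, Finset.mem_range.1 hw, fun n hn u hu hwu => hwT ?_⟩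
  refine Finset.mem_biUnion.2 ⟨n, Finset.mem_range.2 hn, Finset.mem_image.2 ⟨u, ?_, hwu.symm⟩⟩
  rw [Finset.mem_range, Nat.lt_succ_iff, Nat.le_div_iff_mul_le (by positivity)]
  exact hu.le

theorem forall_ne_starFun_of_starRel (f : Std a × ℕ → ℕ) (k : ℕ) {p : M.D a} {w : M.HNat}
    (h : M.starRel (a := Ty.nat) (b := Ty.prod a Ty.nat)
      (fun w q => w < q.2 ∧ ∀ u, u * k < q.2 → w ≠ f (q.1, u)) w (M.pair p v)) :
    M.lt w v ∧ ∀ u, M.lt (M.mul u (M.star (a := Ty.nat) k)) v →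
      w ≠ M.starFun (a := Ty.prod a Ty.nat) (b := Ty.nat) f (M.pair p u) := by
  obtain ⟨e, t, w, p, v, rfl, rfl, rfl⟩ := M.exists_starFun₃ w p v
  rw [pair_starFun] at h
  replace h := (M.starRel_starFun (b := Ty.nat) (c := Ty.prod a Ty.nat) _ _ _ _).1 h
  refine ⟨(M.lt_starFun _ _ _).2 (h.mono fun s hs => hs.1), fun u hu => ?_⟩
  obtain ⟨e', t', t, u, rfl, rfl⟩ := M.exists_starFun₂ t u
  rw [ultra_starFun, eventually_map] at h
  rw [mul_starFun_star, starFun_starFun, lt_starFun] at hu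
  rw [starFun_starFun, starFun_starFun, pair_starFun, Ne,
    M.starFun_starFun (b := Ty.prod a Ty.nat) (c := Ty.nat), starFun_eq_starFun_iff]
  intro hw
  obtain ⟨s, ⟨hs, hus⟩, hws⟩ := ((h.and hu).and hw).exists
  exact hs.2 _ hus hws

theorem exists_lt_forall_ne_starFun (f : Std a × ℕ → ℕ) (P : ℕ → M.D a) (hv : v ∉ M.stdNat) :
    ∃ w, M.lt w v ∧ ∀ (n : ℕ) (u : M.HNat),
      M.lt (M.mul u (M.star (a := Ty.nat) (2 ^ (n + 2) : ℕ))) v →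
        w ≠ M.starFun (a := Ty.prod a Ty.nat) (b := Ty.nat) f (M.pair (P n) u) := by
  let R (n w : ℕ) (q : Std a × ℕ) : Prop :=
    w < q.2 ∧ ∀ u, u * 2 ^ (n + 2) < q.2 → w ≠ f (q.1, u)
  obtain ⟨w, hw⟩ := nonempty_iInter_of_biInter_lt
    (Y := fun n => {w : M.HNat | M.starRel (b := Ty.prod a Ty.nat) (R n) w (M.pair (P n) v)})
    (fun n => isInternal_starRel (a := Ty.nat) (b := Ty.prod a Ty.nat) (R n) _) fun N => by
      obtain ⟨d, t, p, hp⟩ := M.exists_starFun_of_lt P N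
      obtain ⟨e, t', k, g, rfl, rfl⟩ := M.exists_starFun₂ t v
      have hR : ∀ᶠ s in M.ultra t', ∃ w, ∀ n < N, R n w (p n (k s), g s) := by
        filter_upwards [(tendsto_atTop_of_notMem_stdNat hv).eventually_gt_atTop (2 * N)] with s hs
        obtain ⟨w, hws, hw⟩ := exists_lt_forall_ne (fun n u => f (p n (k s), u)) hs
        exact ⟨w, fun n hn => ⟨hws, hw n hn⟩⟩
      obtain ⟨w, hw⟩ := hR.choice
      refine ⟨M.starFun (b := Ty.nat) w t', Set.mem_iInter₂.2 fun n hn => ?_⟩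
      rw [Set.mem_ofPred_eq, hp n hn, starFun_starFun, pair_starFun]
      exact (M.starRel_starFun (b := Ty.nat) (c := Ty.prod a Ty.nat) _ _ _ _).2
        (hw.mono fun s hs => hs n hn)
  have hwR (n : ℕ) := forall_ne_starFun_of_starRel f (2 ^ (n + 2)) (Set.mem_iInter.1 hw n)
  exact ⟨w, (hwR 0).1, fun n => (hwR n).2⟩

/-- A relation is functional if each of its elements is determined by the first component. -/
def IsFunctional (F : Set (M.D (Ty.prod a b))) : Prop :=
  ∀ u w w', M.pair u w ∈ F → M.pair u w' ∈ F → w = w'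

theorem IsFunctional.eq_starFun_sInf {A : M.D (Ty.pow (Ty.prod a Ty.nat))}
    (hA : IsFunctional (M.ext A)) {u : M.D a} {w : M.HNat} (h : M.pair u w ∈ M.ext A) :
    w = M.starFun (a := Ty.prod (Ty.pow (Ty.prod a Ty.nat)) a) (b := Ty.nat)
      (fun q : Set (Std a × ℕ) × Std a => sInf {w | (q.2, w) ∈ q.1}) (M.pair A u) := by
  refine hA u _ _ h ?_
  obtain ⟨e, t, S, f, g, rfl, rfl, rfl⟩ := M.exists_starFun₃ A u w
  have hfg := (M.mem_starFun_iff (b := Ty.prod a Ty.nat) (fun s => (f s, g s)) S t).1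
    (M.pair_starFun (c := Ty.nat) f g t ▸ h)
  rw [pair_starFun, M.starFun_starFun (b := Ty.prod (Ty.pow (Ty.prod a Ty.nat)) a) (c := Ty.nat),
    pair_starFun]
  exact (M.mem_starFun_iff (b := Ty.prod a Ty.nat) _ S t).2
    (hfg.mono fun s hs => Nat.sInf_mem (s := {w | (f s, w) ∈ S s}) ⟨g s, hs⟩)

theorem IsFunctional.exists_of_antitone {C : ℕ → Set (M.D (Ty.prod a b))}
    (hC : ∀ k, M.IsInternal (C k)) (hanti : Antitone C) (h : IsFunctional (⋂ k, C k)) :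
    ∃ k, IsFunctional (C k) := by
  by_contra! hne
  let left (p : Std a × Std b × Std b) : Std a × Std b := (p.1, p.2.1)
  let right (p : Std a × Std b × Std b) : Std a × Std b := (p.1, p.2.2)
  let D (k : ℕ) : Set (M.D (Ty.prod a (Ty.prod b b))) :=
    M.starFun (b := Ty.prod a b) left ⁻¹' C k ∩ M.starFun (b := Ty.prod a b) right ⁻¹' C k ∩
      {z | M.fst (M.snd z) = M.snd (M.snd z)}ᶜ
  have mem_D (k : ℕ) (z) : z ∈ D k ↔ (M.pair (M.fst z) (M.fst (M.snd z)) ∈ C k ∧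
      M.pair (M.fst z) (M.snd (M.snd z)) ∈ C k) ∧ M.fst (M.snd z) ≠ M.snd (M.snd z) := by
    rw [← starFun_fst_fst_snd, ← starFun_fst_snd_snd]
    rfl
  have hD (k : ℕ) : M.IsInternal (D k) :=
    (((hC k).preimage (a := Ty.prod a (Ty.prod b b)) left).inter
      ((hC k).preimage (a := Ty.prod a (Ty.prod b b)) right)).inter
      ((isInternal_starFun_eq (a := Ty.prod b b) Prod.fst Prod.snd).preimage
        (a := Ty.prod a (Ty.prod b b)) Prod.snd).compl
  have hD_nonempty (k : ℕ) : (D k).Nonempty := by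
    obtain ⟨u, w, w', hw, hw', hww'⟩ : ∃ u w w', M.pair u w ∈ C k ∧ M.pair u w' ∈ C k ∧ w ≠ w' := by
      simpa only [IsFunctional, not_forall, exists_prop] using hne k
    refine ⟨M.pair u (M.pair w w'), ?_⟩
    simpa only [mem_D, fst_pair, snd_pair] using ⟨⟨hw, hw'⟩, hww'⟩
  have hD_anti : Antitone D := fun k l hkl => Set.inter_subset_inter_left _
    (Set.inter_subset_inter (Set.preimage_mono (hanti hkl)) (Set.preimage_mono (hanti hkl)))
  obtain ⟨z, hz⟩ := nonempty_iInter_of_antitone hD hD_anti hD_nonempty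
  simp only [Set.mem_iInter, mem_D] at hz
  exact (hz 0).2 (h _ _ _ (Set.mem_iInter.2 fun k => (hz k).1.1)
    (Set.mem_iInter.2 fun k => (hz k).1.2))

theorem IsCD.exists_functional_cover {F : Set (M.D (Ty.prod a b))} (hF : M.IsCD F)
    (hfun : IsFunctional F) :
    ∃ A : ℕ → M.D (Ty.pow (Ty.prod a b)), (∀ n, IsFunctional (M.ext (A n))) ∧
      F ⊆ ⋃ n, M.ext (A n) := by
  obtain ⟨𝒴, hcount, h𝒴, h⟩ := hF.exists_antitone
  let 𝒢 : Set (Set (M.D (Ty.prod a b))) := insert ∅ {C ∈ 𝒴 | IsFunctional C}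
  obtain ⟨G, hG⟩ : ∃ G : ℕ → Set (M.D (Ty.prod a b)), 𝒢 = Set.range G :=
    ((hcount.mono (Set.sep_subset _ _)).insert ∅).exists_eq_range (Set.insert_nonempty _ _)
  have hG𝒢 (n : ℕ) : M.IsInternal (G n) ∧ IsFunctional (G n) := by
    rcases hG ▸ Set.mem_range_self n with hn | hn
    · exact hn ▸ ⟨isInternal_empty, fun _ _ _ h => h.elim⟩
    · exact ⟨h𝒴 _ hn.1, hn.2⟩
  choose A hA using fun n => (hG𝒢 n).1
  refine ⟨A, fun n => hA n ▸ (hG𝒢 n).2, fun z hz => ?_⟩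
  obtain ⟨C, hC, hanti, hzC, hCF⟩ := h z hz
  obtain ⟨k, hk⟩ := IsFunctional.exists_of_antitone (fun k => h𝒴 _ (hC k)) hanti
    fun u w w' hw hw' => hfun u w w' (hCF hw) (hCF hw')
  obtain ⟨n, hn⟩ : C k ∈ Set.range G := hG ▸ Set.mem_insert_of_mem _ ⟨hC k, hk⟩
  exact Set.mem_iUnion.2 ⟨n, hA n ▸ hn ▸ hzC k⟩

theorem IsFunctional.exists_lt_forall_mem_mulNat {F : Set (M.D (Ty.prod Ty.nat Ty.nat))}
    (hfun : IsFunctional F) (hF : M.IsCD F) (hv : v ∉ M.stdNat) :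
    ∃ w, M.lt w v ∧ ∀ u, M.pair u w ∈ F → v ∈ M.mulNat {u} := by
  obtain ⟨A, hA, hcover⟩ := hF.exists_functional_cover hfun
  obtain ⟨w, hwv, hw⟩ := exists_lt_forall_ne_starFun
    (a := Ty.pow (Ty.prod Ty.nat Ty.nat)) (fun q => sInf {w | (q.2, w) ∈ q.1}) A hv
  refine ⟨w, hwv, fun u hu => ?_⟩
  obtain ⟨n, hn⟩ := Set.mem_iUnion.1 (hcover hu)
  by_contra hvu
  refine hw n u (lt_iff_not_le.2 fun hle => hvu ?_) ((hA n).eq_starFun_sInf hn)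
  exact mem_mulNat_singleton.2 ⟨_, hle⟩

theorem mem_mulNat_of_cdLe_below (hxy : x ∉ M.stdNat ∨ y ∉ M.stdNat)
    (h : M.CDLe (M.below y) (M.below x)) : y ∈ M.mulNat {x} := by
  by_contra hyx
  obtain ⟨f, hf, hgraph⟩ := h
  let F : Set (M.D (Ty.prod Ty.nat Ty.nat)) := {z | ∃ w, z = M.pair (f w : M.HNat) (w : M.HNat)}
  have hfun : IsFunctional F := by
    rintro u w w' ⟨z, hz⟩ ⟨z', hz'⟩
    obtain ⟨rfl, rfl⟩ := M.pair_injective hz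
    obtain ⟨hzz', rfl⟩ := M.pair_injective hz'
    exact congrArg _ (hf (Subtype.ext hzz'))
  have hF : M.IsCD F := by
    convert hgraph.image (b := Ty.prod Ty.nat Ty.nat) (fun p : ℕ × ℕ => (p.2, p.1)) using 1
    ext z
    constructor
    · rintro ⟨w, rfl⟩
      exact ⟨_, ⟨w, rfl⟩, M.starFun_swap _ _⟩
    · rintro ⟨_, ⟨w, rfl⟩, rfl⟩
      exact ⟨w, M.starFun_swap _ _⟩
  obtain ⟨w, hw, hwF⟩ :=
    hfun.exists_lt_forall_mem_mulNat hF (notMem_stdNat_of_notMem_mulNat hyx hxy)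
  obtain ⟨n, hn⟩ := mem_mulNat_singleton.1 (hwF _ ⟨⟨w, hw⟩, rfl⟩)
  exact hyx (mem_mulNat_singleton.2
    ⟨n, le_trans hn (mul_le_mul_right (le_of_lt (f ⟨w, hw⟩).2) _)⟩)

theorem not_exists_surjective_isCDMap (hU : M.IsCut U) (hadd : M.IsAdditive U) (hV : M.IsCut V)
    (hUV : U ⊂ V) : ¬ ∃ φ : U → V, Function.Surjective φ ∧ M.IsCDMap φ := by
  rintro ⟨φ, hφ, hgraph⟩
  by_cases hinf : U.Infinite
  · obtain ⟨v, hvV, hvU⟩ := Set.exists_of_ssubset hUV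
    have hfun : IsFunctional
        {z : M.D (Ty.prod Ty.nat Ty.nat) | ∃ x : U, z = M.pair (x : M.HNat) (φ x : M.HNat)} := by
      rintro u w w' ⟨z, hz⟩ ⟨z', hz'⟩
      obtain ⟨rfl, rfl⟩ := M.pair_injective hz
      obtain ⟨hzz', rfl⟩ := M.pair_injective hz'
      rw [Subtype.ext hzz']
    obtain ⟨w, hwv, hw⟩ :=
      hfun.exists_lt_forall_mem_mulNat hgraph fun hv => hvU (hU.stdNat_subset hinf hv)
    obtain ⟨z, hz⟩ := hφ ⟨w, hV v hvV w (le_of_lt hwv)⟩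
    have hvz : v ∈ M.mulNat {(z : M.HNat)} := hw z ⟨z, by rw [hz]⟩
    rw [← hU.mulNat_eq hadd] at hvU
    exact hvU (mulNat_mono (Set.singleton_subset_iff.2 z.2) hvz)
  · have hUfin : Finite U := Set.not_infinite.1 hinf
    have hVfin : V.Finite := Finite.of_surjective φ hφ
    exact (Set.ncard_lt_ncard hUV hVfin).not_ge (Nat.card_le_card_of_surjective φ hφ)

end Counting

section Cuts

variable {M : NonstandardUniverse.{u}} {a : Ty} {x y : M.HNat} {U : Set M.HNat}

theorem isInternal_below (x : M.HNat) : M.IsInternal (M.below x) :=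
  isInternal_starRel (a := Ty.nat) (b := Ty.nat) (fun m n : ℕ => m < n) x

theorem below_subset_mulNat (h : x ∈ M.mulNat {y}) : M.below x ⊆ M.mulNat {y} :=
  fun z hz => isCut_mulNat _ x h z (le_of_lt hz)

theorem cdLe_below_of_mem_mulNat (hxy : x ∉ M.stdNat ∨ y ∉ M.stdNat) (hx : x ∈ M.mulNat {y}) :
    M.CDLe (M.below x) (M.below y) := by
  have hy : y ∉ M.stdNat := by
    intro hy
    refine hxy.elim (fun hx' => hx' ?_) fun hy' => hy' hy
    rw [← isCut_stdNat.mulNat_eq isAdditive_stdNat]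
    exact mulNat_mono (Set.singleton_subset_iff.2 hy) hx
  exact (cdLe_of_subset (isInternal_below x).isCD (below_subset_mulNat hx)).trans
    (cdLe_mulNat_singleton_below hy)

theorem cdEquiv_below_iff (hy : y ≠ M.star (a := Ty.nat) (0 : ℕ))
    (hxy : x ∉ M.stdNat ∨ y ∉ M.stdNat) : M.CDEquiv (M.below x) (M.below y) ↔
      0 < M.st (M.ratio x y) ∧ M.st (M.ratio x y) < ⊤ := by
  rw [st_ratio_pos_lt_top_iff hy]
  exact and_congr
    ⟨mem_mulNat_of_cdLe_below hxy.symm, cdLe_below_of_mem_mulNat hxy⟩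
    ⟨mem_mulNat_of_cdLe_below hxy, cdLe_below_of_mem_mulNat hxy.symm⟩

theorem IsCut.exists_mulNat_eq_mulNat_singleton (hU : M.IsCut U) (hinf : U.Infinite)
    (hadd : ¬ M.IsAdditive U) : ∃ x ∈ U, x ∉ M.stdNat ∧ M.mulNat U = M.mulNat {x} := by
  obtain ⟨x, hx, y, hy, hxy⟩ : ∃ x ∈ U, ∃ y ∈ U, M.add x y ∉ U := by
    simpa only [IsAdditive, not_forall, exists_prop] using hadd
  obtain ⟨z, hz, hxz, hyz⟩ : ∃ z ∈ U, M.le x z ∧ M.le y z :=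
    (le_total x y).elim (fun h => ⟨y, hy, h, le_refl y⟩) fun h => ⟨x, hx, le_refl x, h⟩
  have hz₂ : M.mul z (M.star (a := Ty.nat) (2 : ℕ)) ∉ U := fun h =>
    hxy (hU _ h _ (add_le_mul_two hxz hyz))
  refine ⟨z, hz, fun hstd => hz₂ ?_,
    Set.Subset.antisymm ?_ (mulNat_mono (Set.singleton_subset_iff.2 hz))⟩
  · exact hU.stdNat_subset hinf (isCut_stdNat.mul_star_mem isAdditive_stdNat hstd 2)
  · rw [← mulNat_mulNat {z}]
    exact mulNat_mono fun w hw => mem_mulNat_singleton.2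
      ⟨2, (le_total _ _).resolve_right fun h => hz₂ (hU w hw _ h)⟩

theorem IsCut.mulNat_cdLe (hU : M.IsCut U) (hCD : M.IsCD U) (hinf : U.Infinite) :
    M.CDLe (M.mulNat U) U := by
  by_cases hadd : M.IsAdditive U
  · rw [hU.mulNat_eq hadd]
    exact cdLe_of_subset hCD subset_rfl
  · obtain ⟨x, hx, hstd, hUx⟩ := hU.exists_mulNat_eq_mulNat_singleton hinf hadd
    rw [hUx]
    exact (cdLe_mulNat_singleton_below hstd).trans
      (cdLe_of_subset (isInternal_below x).isCD fun y hy => hU x hx y (le_of_lt hy))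

theorem injective_two_pow_mul_odd :
    Function.Injective fun p : ℕ × ℕ => 2 ^ p.1 * (2 * p.2 + 1) := by
  rintro ⟨m, x⟩ ⟨n, y⟩ h
  induction m generalizing n with
  | zero => cases n <;> grind
  | succ m ih => cases n <;> grind

theorem IsCut.prodSet_stdNat_cdLe_mulNat (hU : M.IsCut U) (hCD : M.IsCD U) (hinf : U.Infinite) :
    M.CDLe (M.prodSet M.stdNat U) (M.mulNat U) := by
  refine cdLe_of_starFun (a := Ty.prod Ty.nat Ty.nat) (b := Ty.nat) (isCD_stdNat.prodSet hCD) _ ?_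
    (M.starFun_injective (a := Ty.prod Ty.nat Ty.nat) (b := Ty.nat) injective_two_pow_mul_odd).injOn
  rintro _ ⟨_, ⟨n, rfl⟩, x, hx, rfl⟩
  obtain ⟨y, hy, hxy, h1y⟩ : ∃ y ∈ U, M.le x y ∧ M.le (M.star (a := Ty.nat) (1 : ℕ)) y :=
    (le_total x (M.star (a := Ty.nat) (1 : ℕ))).elim
      (fun h => ⟨_, hU.stdNat_subset hinf ⟨1, rfl⟩, h, le_refl _⟩) fun h => ⟨x, hx, le_refl x, h⟩
  refine mem_mulNat.2 ⟨y, hy, 2 ^ n * 3, ?_⟩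
  obtain ⟨e, t, f, g, rfl, rfl⟩ := M.exists_starFun₂ x y
  rw [← M.starFun_const (b := Ty.nat) _ t, le_starFun] at h1y
  rw [le_starFun] at hxy
  dsimp only
  rw [← M.starFun_const (b := Ty.nat) n t, pair_starFun, mul_starFun_star,
    M.starFun_starFun (b := Ty.prod Ty.nat Ty.nat) (c := Ty.nat), le_starFun]
  filter_upwards [hxy, h1y] with s hfg hg
  calc 2 ^ n * (2 * f s + 1) ≤ 2 ^ n * (g s * 3) := Nat.mul_le_mul_left _ (by omega)
    _ = g s * (2 ^ n * 3) := by ring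

theorem IsCD.cdLe_prodSet_stdNat {X : Set (M.D a)} (hX : M.IsCD X) :
    M.CDLe X (M.prodSet M.stdNat X) := by
  refine cdLe_of_starFun (b := Ty.prod Ty.nat a) hX (fun s => ((0 : ℕ), s)) (fun x hx => ?_)
    (M.starFun_injective (b := Ty.prod Ty.nat a) (Prod.mk_right_injective 0)).injOn
  have h := M.pair_starFun (b := Ty.nat) (c := a) (fun _ => 0) (fun s => s) x
  rw [starFun_id, starFun_const (b := Ty.nat)] at h
  exact ⟨_, ⟨0, rfl⟩, x, hx, h.symm⟩

theorem IsCut.cdEquiv_of_infinite (hU : M.IsCut U) (hCD : M.IsCD U) (hinf : U.Infinite) :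
    M.CDEquiv U (M.prodSet M.stdNat U) ∧ M.CDEquiv U (M.mulNat U) :=
  ⟨⟨hCD.cdLe_prodSet_stdNat,
      (hU.prodSet_stdNat_cdLe_mulNat hCD hinf).trans (hU.mulNat_cdLe hCD hinf)⟩,
    cdLe_of_subset hCD (subset_mulNat U), hU.mulNat_cdLe hCD hinf⟩

end Cuts

end NonstandardUniverse

theorem mainTheorem6_general (M : NonstandardUniverse.{u}) :
    (∀ U : Set M.HNat, M.IsCut U → M.IsCD U → U.Infinite →
      M.CDEquiv U (M.prodSet M.stdNat U) ∧ M.CDEquiv U (M.mulNat U)) ∧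
    (∀ U V : Set M.HNat, M.IsCut U → M.IsCut V → U ⊂ V → M.IsAdditive U →
      ¬ ∃ φ : U → V, Function.Surjective φ ∧ M.IsCDMap φ) ∧
    (∀ x y : M.HNat, y ≠ M.star (a := Ty.nat) (0 : ℕ) → (x ∉ M.stdNat ∨ y ∉ M.stdNat) →
      (M.CDEquiv (M.below x) (M.below y) ↔
        0 < M.st (M.ratio x y) ∧ M.st (M.ratio x y) < ⊤)) :=
  ⟨fun _ hU hCD hinf => hU.cdEquiv_of_infinite hCD hinf,
    fun _ _ hU hV hUV hadd => NonstandardUniverse.not_exists_surjective_isCDMap hU hadd hV hUV,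
    fun _ _ hy hxy => NonstandardUniverse.cdEquiv_below_iff hy hxy⟩

theorem mainTheorem6 (M : NonstandardUniverse.{u}) :
    (∀ U : Set M.HNat, M.IsCut U → M.IsBorel U → U.Infinite →
      M.CDEquiv U (M.prodSet M.stdNat U) ∧ M.CDEquiv U (M.mulNat U)) ∧
    (∀ U V : Set M.HNat, M.IsCut U → M.IsBorel U → M.IsCut V → M.IsBorel V →
      U ⊂ V → M.IsAdditive U →
      ¬ ∃ φ : U → V, Function.Surjective φ ∧ M.IsCDMap φ) ∧
    (∀ x y : M.HNat, y ≠ M.star (a := Ty.nat) (0 : ℕ) → (x ∉ M.stdNat ∨ y ∉ M.stdNat) →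
      (M.CDEquiv (M.below x) (M.below y) ↔
        0 < M.st (M.ratio x y) ∧ M.st (M.ratio x y) < ⊤)) :=
  have ⟨infinite, additive, below⟩ := mainTheorem6_general M
  ⟨fun U hU hB => infinite U hU hB.isCD, fun U V hU _ hV _ => additive U V hU hV, below⟩
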